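/- Let $Y_\ell^m(\theta,\phi)=\sqrt{\tfrac{2\ell+1}{4\pi}\tfrac{(\ell-m)!}{(\ell+m)!}}\,P_\ell^m(\cos\theta)\,e^{im\phi}$ be the orthonormal spherical harmonics on the unit sphere $\mathbb S^2$ with its area measure $ds=\sin\theta\,d\theta\,d\phi$, where $P_\ell^m(t)=\frac{(-1)^m}{2^\ell\ell!}(1-t^2)^{m/2}\frac{d^{\ell+m}}{dt^{\ell+m}}(t^2-1)^\ell$ and $P_\ell^{-m}=(-1)^m\frac{(\ell-m)!}{(\ell+m)!}P_\ell^m$ for $0\le m\le\ell$. Index them by the single integer $n=\ell^2+\ell+m$, write $(\ell,m)\leftrightarrow n$ and $Y_n=Y_\ell^m$, and let $(f)_n=(f)_\ell^m=\langle f,Y_n\rangle=\int_{\mathbb S^2}f\,\overline{Y_n}\,ds$ for $f\in L^2(\mathbb S^2)$. A function $f\in L^2(\mathbb S^2)$ is band-limited with maximum degree $L$ if $(f)_\ell^m=0$ for all $\ell>L$. The spherical convolution is $(g\circledast\zeta)(y)=\sum_{n}(g)_n(\zeta)_nY_n(y)$. Let $h\in L^2(\mathbb S^2)$ be an azimuthally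 symmetric window (a function of the co-latitude $\theta$ only) with $\|h\|=1$ that is band-limited with maximum degree $L_h$, and put $N_h=L_h^2+2L_h$. For $y\in\mathbb S^2$ with co-latitude $\vartheta$ and longitude $\varphi$ let $\mathcal D(y)h$ be $h$ rotated by $\vartheta$ about the $y$-axis and then by $\varphi$ about the $z$-axis. The SLSHT (spatially localized spherical harmonic transform) distribution of a signal $f\in L^2(\mathbb S^2)$ has the components $$g_f(y;n)=\int_{\mathbb S^2}(\mathcal D(y)h)(x)\,f(x)\,\overline{Y_n(x)}\,ds(x),\qquad n=0,1,2,\dots$$ Let the observation be $f=s+z$, where the signal $s$ and the noise $z$ are zero-mean, possibly anisotropic, complex random processes on the sphere with realisations in $L^2(\mathbb S^2)$ and finite expected energy $\mathbb E\|s\|^2,\ \mathbb E\|z\|^2<\infty$, which are uncorrelated: $\mathbb E\{(s)_n\overline{(z)_r}\}=0$ for all $n,r$. Let $\mathbf C_S^{nr}=\mathbb E\{(s)_n\overline{(s)_r}\}$ and $\mathbf C_Z^{nr}=\mathbb E\{(z)_n\overline{(z)_r}\}$ be their spectral covariance matrices. A filter is a sequence $\zeta=(\zeta(\cdot;n))_{n\ge0}$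 of functions in $L^2(\mathbb S^2)$ that are band-limited with maximum degree $L_h$; write $(\zeta_n)_r=\langle\zeta(\cdot;n),Y_r\rangle$. Its spatio-spectral mean-square error is $$\mathcal E_{ss}(\zeta)=\mathbb E\Big\{\sum_{n=0}^\infty\big\|g_f(\cdot;n)\circledast\zeta(\cdot;n)-g_s(\cdot;n)\big\|^2\Big\}.$$ Let $T(c;r;n)=\int_{\mathbb S^2}Y_r\,Y_c\,\overline{Y_n}\,ds$ and, for $(p,q)\leftrightarrow r$, $$H(c;r;n)=(-1)^q\sqrt{\frac{4\pi}{2p+1}}\;(h)_p^0\;T(c;p,-q;n),$$ where $T(c;p,-q;n)=T(c;r';n)$ with $(p,-q)\leftrightarrow r'$. Then the filter with the coefficients $$(\zeta_n)_r=\frac{\sum_{c=0}^\infty\sum_{c'=0}^\infty H(c;r;n)\,H(c';r;n)\,\mathbf C_S^{cc'}}{\sum_{c=0}^\infty\sum_{c'=0}^\infty H(c;r;n)\,H(c';r;n)\,\big(\mathbf C_S^{cc'}+\mathbf C_Z^{cc'}\big)},\qquad n\ge0,\ 0\le r\le N_h,$$ wherever the denominator is non-zero, and $(\zeta_n)_r=0$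 where the denominator vanishes, exists and minimises $\mathcal E_{ss}$ among all filters. Conversely, every filter that minimises $\mathcal E_{ss}$ has these coefficients $(\zeta_n)_r$ for all $n\ge0$ and $0\le r\le N_h$ at which the denominator is non-zero. -/

import Mathlib

open MeasureTheory
open scoped ENNReal ComplexConjugate

noncomputable section

namespace SLSHT

/-! ### The unit sphere, its area measure and spherical coordinates -/

/-- The unit sphere in Euclidean three-space. -/
abbrev S2 : Type := Metric.sphere (0 : EuclideanSpace ℝ (Fin 3)) 1

/-- The surface area measure `sin θ dθ dφ` on the sphere (of total mass `4π`). -/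
def area : Measure S2 := (volume : Measure (EuclideanSpace ℝ (Fin 3))).toSphere

/-- The co-latitude `θ ∈ [0, π]`. -/
def colatitude (x : S2) : ℝ := Real.arccos (x.1 2)

/-- The longitude `φ`, determined modulo `2π`; by convention it is `0` at the two poles. -/
def longitude (x : S2) : ℝ := Complex.arg ⟨x.1 0, x.1 1⟩

/-! ### Spherical harmonics -/

/-- The associated Legendre function of degree `l` and order `m ≥ 0`, with the
Condon-Shortley phase. -/
def legendreNonneg (l m : ℕ) (t : ℝ) : ℝ :=
  (-1) ^ m / (2 ^ l * (l.factorial : ℝ)) * Real.sqrt (1 - t ^ 2) ^ m *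
    ((Polynomial.derivative^[l + m] ((Polynomial.X ^ 2 - 1) ^ l : Polynomial ℝ)).eval t)

/-- The associated Legendre function of degree `l` and order `-l ≤ m ≤ l`. -/
def legendre (l : ℕ) (m : ℤ) (t : ℝ) : ℝ :=
  if 0 ≤ m then legendreNonneg l m.natAbs t
  else (-1) ^ m.natAbs * (((l - m.natAbs).factorial : ℝ) / ((l + m.natAbs).factorial : ℝ)) *
    legendreNonneg l m.natAbs t

/-- The normalisation factor of the spherical harmonic of degree `l` and order `m`. -/
def normFactor (l : ℕ) (m : ℤ) : ℝ :=
  Real.sqrt ((2 * l + 1) / (4 * Real.pi) *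
    (((l - m).toNat.factorial : ℝ) / ((l + m).toNat.factorial : ℝ)))

/-- The spherical harmonic of degree `l` and order `m`. -/
def sphHarm (l : ℕ) (m : ℤ) (x : S2) : ℂ :=
  ((normFactor l m * legendre l m (Real.cos (colatitude x)) : ℝ) : ℂ) *
    Complex.exp (Complex.I * m * longitude x)

/-- The degree `l = ⌊√n⌋` of the single index `n = l² + l + m`. -/
def deg (n : ℕ) : ℕ := Nat.sqrt n

/-- The order `m = n - l (l + 1)` of the single index `n = l² + l + m`. -/
def ord (n : ℕ) : ℤ := (n : ℤ) - (deg n : ℤ) * ((deg n : ℤ) + 1)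

/-- The single index `l² + l + m` of the pair `(l, m)`, for `-l ≤ m ≤ l`. -/
def idx (l : ℕ) (m : ℤ) : ℕ := ((l : ℤ) ^ 2 + l + m).toNat

/-- The spherical harmonics with the single index. -/
def Y (n : ℕ) (x : S2) : ℂ := sphHarm (deg n) (ord n) x

/-- The spherical harmonic coefficient `⟨f, Y_n⟩`. -/
def coeff (f : S2 → ℂ) (n : ℕ) : ℂ := ∫ x, f x * conj (Y n x) ∂area

/-- `f` is square integrable and band-limited with maximum spectral degree `L`. -/
def IsBandLimited (L : ℕ) (f : S2 → ℂ) : Prop :=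
  MemLp f 2 area ∧ ∀ n, L < deg n → coeff f n = 0

/-- The spherical harmonic triple product. -/
def T (c r n : ℕ) : ℂ := ∫ x, Y r x * Y c x * conj (Y n x) ∂area

/-- Spherical convolution, defined as multiplication of the harmonic coefficients. -/
def conv (h f : S2 → ℂ) (y : S2) : ℂ := ∑' n, coeff h n * coeff f n * Y n y

/-! ### Rotations -/

lemma norm_sq_coord (x : S2) : x.1 0 ^ 2 + x.1 1 ^ 2 + x.1 2 ^ 2 = 1 := by
  have h := EuclideanSpace.norm_sq_eq x.1
  have hx : ‖x.1‖ = 1 := by simp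
  rw [hx, Fin.sum_univ_three] at h
  simp only [Real.norm_eq_abs, sq_abs] at h
  linarith

lemma mem_sphere_of_sq {a b c : ℝ} (h : a ^ 2 + b ^ 2 + c ^ 2 = 1) :
    !₂[a, b, c] ∈ Metric.sphere (0 : EuclideanSpace ℝ (Fin 3)) 1 := by
  rw [mem_sphere_zero_iff_norm, EuclideanSpace.norm_eq, Fin.sum_univ_three]
  simp [h]

/-- Rotation of the sphere by the angle `a` about the `z`-axis. -/
def rotZ (a : ℝ) (x : S2) : S2 :=
  ⟨!₂[Real.cos a * x.1 0 - Real.sin a * x.1 1, Real.sin a * x.1 0 + Real.cos a * x.1 1, x.1 2],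
    mem_sphere_of_sq (by
      linear_combination norm_sq_coord x + (x.1 0 ^ 2 + x.1 1 ^ 2) * Real.sin_sq_add_cos_sq a)⟩

/-- Rotation of the sphere by the angle `a` about the `y`-axis. -/
def rotY (a : ℝ) (x : S2) : S2 :=
  ⟨!₂[Real.cos a * x.1 0 + Real.sin a * x.1 2, x.1 1, -Real.sin a * x.1 0 + Real.cos a * x.1 2],
    mem_sphere_of_sq (by
      linear_combination norm_sq_coord x + (x.1 0 ^ 2 + x.1 2 ^ 2) * Real.sin_sq_add_cos_sq a)⟩

/-- The rotation operator `𝓓(y)`, for `y` with co-latitude `ϑ` and longitude `φ`: the function is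
rotated by `ϑ` about the `y`-axis, then by `φ` about the `z`-axis. So `(𝓓(y) h)(x) = h(R⁻¹ x)`
where `R = R_z(φ) R_y(ϑ)`. -/
def rotate (y : S2) (h : S2 → ℂ) (x : S2) : ℂ :=
  h (rotY (-colatitude y) (rotZ (-longitude y) x))

/-! ### Windows, the SLSHT distribution and filters -/

/-- An azimuthally symmetric window of unit energy, band-limited with maximum degree `L`. -/
structure IsWindow (L : ℕ) (h : S2 → ℂ) : Prop where
  bandLimited : IsBandLimited L h
  symmetric : ∀ x x' : S2, colatitude x = colatitude x' → h x = h x'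
  unit_energy : ∫ x, ‖h x‖ ^ 2 ∂area = 1

/-- The component `g_f(y; n)` of the SLSHT distribution of `f` with window `h`. -/
def slsht (h f : S2 → ℂ) (n : ℕ) (y : S2) : ℂ :=
  ∫ x, rotate y h x * f x * conj (Y n x) ∂area

/-- A filter function `ζ(·; n)`, `n = 0, 1, 2, …`, whose components are all band-limited with
maximum degree `L`. -/
def IsFilter (L : ℕ) (ζ : ℕ → S2 → ℂ) : Prop := ∀ n, IsBandLimited L (ζ n)

/-- The filtered distribution `v(y; n)` for the input `f`. -/
def filtered (h f : S2 → ℂ) (ζ : ℕ → S2 → ℂ) (n : ℕ) : S2 → ℂ := conv (slsht h f n) (ζ n)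

/-- The quantity `H(c; r; n)`, where `(p, q) ↔ r`. -/
def H (h : S2 → ℂ) (c r n : ℕ) : ℂ :=
  (-1) ^ (ord r).natAbs * (Real.sqrt (4 * Real.pi / (2 * deg r + 1)) : ℂ) *
    coeff h (idx (deg r) 0) * T c (idx (deg r) (-ord r)) n

/-! ### Random processes on the sphere -/

section RandomField

variable {Ω : Type*} [MeasurableSpace Ω]

/-- A zero-mean random process on the sphere with finite expected energy: almost all realisations
are signals in `L²`, the spectral coefficients are random variables of mean zero. It may be
anisotropic, and it need not be Gaussian. -/
structure IsZeroMeanProcess (P : Measure Ω) (s : Ω → S2 → ℂ) : Prop where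
  memLp : ∀ᵐ ω ∂P, MemLp (s ω) 2 area
  aestronglyMeasurable_coeff : ∀ n, AEStronglyMeasurable (fun ω => coeff (s ω) n) P
  finite_energy : ∫⁻ ω, ∫⁻ x, ‖s ω x‖ₑ ^ 2 ∂area ∂P < ∞
  mean_zero : ∀ n, ∫ ω, coeff (s ω) n ∂P = 0

/-- The spectral covariance matrix of a zero-mean process. -/
def specCov (P : Measure Ω) (s : Ω → S2 → ℂ) (n r : ℕ) : ℂ :=
  ∫ ω, coeff (s ω) n * conj (coeff (s ω) r) ∂P

/-- The two processes are uncorrelated. -/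
def Uncorrelated (P : Measure Ω) (s z : Ω → S2 → ℂ) : Prop :=
  ∀ n r, ∫ ω, coeff (s ω) n * conj (coeff (z ω) r) ∂P = 0

/-- The spatio-spectral mean-square error between the filtered distribution of the
input `f` and the SLSHT distribution of the signal `s`. -/
def mse (P : Measure Ω) (h : S2 → ℂ) (f s : Ω → S2 → ℂ) (ζ : ℕ → S2 → ℂ) : ℝ≥0∞ :=
  ∫⁻ ω, ∑' n, ∫⁻ y, ‖filtered h (f ω) ζ n y - slsht h (s ω) n y‖ₑ ^ 2 ∂area ∂P

/-- The filter `ζ` minimises the spatio-spectral mean-square error among all filters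
band-limited with maximum degree `L`. -/
def IsOptimalFilter (P : Measure Ω) (L : ℕ) (h : S2 → ℂ) (f s : Ω → S2 → ℂ)
    (ζ : ℕ → S2 → ℂ) : Prop :=
  IsFilter L ζ ∧ ∀ ξ, IsFilter L ξ → mse P h f s ζ ≤ mse P h f s ξ

end RandomField

/-- The double sum of `H(c; r; n) H(c'; r; n) C^{cc'}` over all `c` and `c'`. -/
def quadSum (h : S2 → ℂ) (C : ℕ → ℕ → ℂ) (r n : ℕ) : ℂ :=
  ∑' c, ∑' c', H h c r n * H h c' r n * C c c'

end SLSHT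

end

/-! The mean-square error splits into independent scalar least-squares problems, one for each pair
`(n, r)`.

A symmetric band-limited window is almost everywhere a finite combination of zonal harmonics
(`window_ae_eq`; this is where completeness of the harmonics is needed). By the addition theorem
`zonal_rotate`, its rotation to `y` is a finite sum of multiples of `conj (Y r y) * Y r x`.
Integrating against `f` shows that `g_f(·; n)` is band-limited, with `r`-th coefficient
`windowFactor h r` times the `n`-th coefficient of `Y (negIdx r) * f` (`slsht_eq`). The latter is a
finite combination of the coefficients of `f`, weighted by triple products (`coeff_Y_mul`).
Convolution is diagonal in this basis, so Parseval turns the error into a sum over `(n, r)`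
(`mse_eq`).

In one summand, let `U` and `V` be the random variables coming from signal and noise, and let `a`,
`b` be their mean energies. Since `U` and `V` are uncorrelated, a coefficient `w` costs
`|windowFactor|² (|w - 1|² a + |w|² b)`. Completing the square gives the minimiser `a / (a + b)`
(`filter_error_eq`). The triple products are real (`conj_T`), so the double sums in the theorem are
`windowFactor²` times `a` and `a + b` (`quadSum_specCov`), and the factor cancels in the quotient.
Where the denominator vanishes, the summand is zero for every `w`. Uniqueness elsewhere needs the
minimal error to be finite; it is at most the error of the zero filter, which Bessel's inequality
bounds (`tsum_errTerm_zero_lt_top`).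

The facts on harmonics rest on two computations. Orthonormality combines Rodrigues' formula with
Archimedes' hat-box theorem. The identity `affineSpan_pow_eq` between harmonics and polynomials of
bounded degree gives stability under products and isometries, hence the addition theorem, the finite
support of the triple products and, by Stone–Weierstrass, completeness. -/

noncomputable section

namespace SLSHT

/-! ### Rodrigues polynomials and their orthogonality -/

section Rodrigues

open Polynomial

/-- The polynomial `D^(l+m) (X² - 1)^l`. -/
def rodrigues (l m : ℕ) : ℝ[X] := derivative^[l + m] ((X ^ 2 - 1) ^ l)

lemma intervalIntegrable_eval (p : ℝ[X]) (a b : ℝ) :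
    IntervalIntegrable (fun t => p.eval t) volume a b :=
  p.continuous.intervalIntegrable a b

lemma integral_eval_derivative (p : ℝ[X]) (a b : ℝ) :
    ∫ t in a..b, (derivative p).eval t = p.eval b - p.eval a :=
  intervalIntegral.integral_eq_sub_of_hasDerivAt (fun t _ => p.hasDerivAt t)
    (intervalIntegrable_eval _ _ _)

/-- Integration by parts `N` times; the two hypotheses are exactly the vanishing of all boundary
terms that arise. -/
lemma integral_iterate_derivative_mul (N : ℕ) (p q : ℝ[X]) (a b : ℝ)
    (ha : ∀ i j, i + j + 1 = N → (derivative^[j] p * derivative^[i] q).eval a = 0)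
    (hb : ∀ i j, i + j + 1 = N → (derivative^[j] p * derivative^[i] q).eval b = 0) :
    ∫ t in a..b, (derivative^[N] p * q).eval t =
      (-1) ^ N * ∫ t in a..b, (p * derivative^[N] q).eval t := by
  induction N generalizing q with
  | zero => simp
  | succ N ih =>
    have h1 := integral_eval_derivative (derivative^[N] p * q) a b
    have ha' := ha 0 N (by omega)
    have hb' := hb 0 N (by omega)
    simp only [Function.iterate_zero, id] at ha' hb'
    rw [ha', hb', derivative_mul, ← Function.iterate_succ_apply' derivative] at h1
    simp only [eval_add] at h1
    rw [intervalIntegral.integral_add (intervalIntegrable_eval _ _ _)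
      (intervalIntegrable_eval _ _ _)] at h1
    have h2 := ih (derivative q)
      (fun i j hij => by simpa using ha (i + 1) j (by omega))
      (fun i j hij => by simpa using hb (i + 1) j (by omega))
    rw [h2] at h1
    rw [Function.iterate_succ_apply (f := derivative) (x := q), pow_succ]
    linarith

lemma iterate_derivative_of_natDegree_le {N : ℕ} {q : ℝ[X]} (h : q.natDegree ≤ N) :
    derivative^[N] q = C ((N.factorial : ℝ) * q.coeff N) := by
  ext k
  rw [coeff_iterate_derivative, coeff_C]
  split_ifs with hk
  · simp [hk, Nat.descFactorial_self]
  · rw [coeff_eq_zero_of_natDegree_lt (by omega), smul_zero]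

lemma natDegree_sq_sub_one_pow (l : ℕ) : ((X ^ 2 - 1 : ℝ[X]) ^ l).natDegree = 2 * l := by
  have : (X ^ 2 - 1 : ℝ[X]) = X ^ 2 - C 1 := by simp
  rw [natDegree_pow, this, natDegree_X_pow_sub_C, mul_comm]

lemma coeff_sq_sub_one_pow (l : ℕ) : ((X ^ 2 - 1 : ℝ[X]) ^ l).coeff (2 * l) = 1 := by
  have h1 : (X ^ 2 - 1 : ℝ[X]).Monic := by
    have : (X ^ 2 - 1 : ℝ[X]) = X ^ 2 - C 1 := by simp
    rw [this]
    exact monic_X_pow_sub_C _ two_ne_zero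
  rw [← natDegree_sq_sub_one_pow]
  exact (h1.pow l).coeff_natDegree

lemma natDegree_rodrigues_le (l m : ℕ) : (rodrigues l m).natDegree ≤ l - m := by
  refine (natDegree_iterate_derivative _ _).trans ?_
  rw [natDegree_sq_sub_one_pow]
  omega

lemma coeff_rodrigues {l m : ℕ} (h : m ≤ l) :
    (rodrigues l m).coeff (l - m) = (2 * l).factorial / (l - m).factorial := by
  have h2 : l - m + (l + m) = 2 * l := by omega
  rw [rodrigues, coeff_iterate_derivative, h2, coeff_sq_sub_one_pow, nsmul_eq_mul, mul_one,
    eq_div_iff (by positivity), ← Nat.cast_mul, mul_comm]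
  have := Nat.factorial_mul_descFactorial (n := 2 * l) (k := l + m) (by omega)
  rw [show 2 * l - (l + m) = l - m by omega] at this
  exact_mod_cast this

/-- Each derivative lowers the multiplicity of the zeros at `±1` by at most one. -/
lemma eval_iterate_derivative_sq_sub_one {p : ℝ[X]} {k j : ℕ} (hp : (X ^ 2 - 1 : ℝ[X]) ^ k ∣ p)
    (hj : j < k) {t : ℝ} (ht : t ^ 2 = 1) : (derivative^[j] p).eval t = 0 := by
  have h1 := pow_sub_dvd_iterate_derivative_of_pow_dvd j hp
  have h2 : (X ^ 2 - 1 : ℝ[X]) ∣ derivative^[j] p :=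
    (dvd_pow_self _ (by omega)).trans h1
  obtain ⟨c, hc⟩ := h2
  simp [hc, ht]

lemma integral_sq_sub_one_pow (l : ℕ) :
    ∫ t in (-1 : ℝ)..1, ((X ^ 2 - 1 : ℝ[X]) ^ l).eval t =
      (-1) ^ l * (2 ^ (2 * l + 1) * (l.factorial : ℝ) ^ 2 / (2 * l + 1).factorial) := by
  induction l with
  | zero => norm_num
  | succ l ih =>
    -- This polynomial vanishes at `±1`; integrating its derivative gives the recursion `(2l + 3)
    -- I_{l+1} = -2(l + 1) I_l`.
    have h1 := integral_eval_derivative (X * (X ^ 2 - 1 : ℝ[X]) ^ (l + 1)) (-1) 1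
    have h2 : derivative (X * (X ^ 2 - 1 : ℝ[X]) ^ (l + 1)) =
        C (2 * l + 3 : ℝ) * (X ^ 2 - 1 : ℝ[X]) ^ (l + 1)
          + C (2 * (l + 1) : ℝ) * (X ^ 2 - 1 : ℝ[X]) ^ l := by
      simp only [derivative_mul, derivative_X, derivative_pow, derivative_sub, derivative_one,
        map_add, map_mul, map_natCast, map_one, map_ofNat, Nat.cast_add, Nat.cast_one,
        add_tsub_cancel_right, Nat.cast_ofNat]
      ring
    rw [h2] at h1
    simp only [eval_add, eval_mul, eval_C] at h1
    rw [intervalIntegral.integral_add ((intervalIntegrable_eval _ _ _).const_mul _)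
      ((intervalIntegrable_eval _ _ _).const_mul _), intervalIntegral.integral_const_mul,
      intervalIntegral.integral_const_mul, ih] at h1
    have h3 : (2 * (l + 1) + 1).factorial = (2 * l + 3) * ((2 * l + 2) * (2 * l + 1).factorial) := by
      rw [show 2 * (l + 1) + 1 = (2 * l + 2) + 1 by ring, Nat.factorial_succ, Nat.factorial_succ]
    rw [h3, Nat.factorial_succ]
    push_cast
    have h4 : (2 * l + 3 : ℝ) ≠ 0 := by positivity
    have h5 : (2 * l + 2 : ℝ) ≠ 0 := by positivity
    have h6 : ((2 * l + 1).factorial : ℝ) ≠ 0 := by positivity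
    have h7 : (l + 1 : ℝ) ≠ 0 := by positivity
    apply mul_left_cancel₀ h4
    have h8 : (2 * l + 3 : ℝ) * ∫ t in (-1 : ℝ)..1, ((X ^ 2 - 1 : ℝ[X]) ^ (l + 1)).eval t =
        - (2 * (l + 1) * ((-1) ^ l *
          (2 ^ (2 * l + 1) * (l.factorial : ℝ) ^ 2 / (2 * l + 1).factorial))) := by
      have h9 : eval (1 : ℝ) ((X ^ 2 - 1 : ℝ[X]) ^ (l + 1)) = 0 := by simp
      have h10 : eval (-1 : ℝ) ((X ^ 2 - 1 : ℝ[X]) ^ (l + 1)) = 0 := by simp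
      rw [h9, h10] at h1
      linarith
    rw [h8]
    field_simp
    ring

/-- All `l + m` derivatives are moved onto a polynomial of degree at most `l' + m`. Nothing is left
if `l' < l`; if `l' = l` only the leading coefficient remains, times the integral of `(X² - 1)^l`.
-/
lemma integral_rodrigues_mul (l l' m : ℕ) (hl : l' ≤ l) (hm : m ≤ l') :
    ∫ t in (-1 : ℝ)..1, (rodrigues l m * ((X ^ 2 - 1) ^ m * rodrigues l' m)).eval t =
      if l = l' then (-1 : ℝ) ^ m * (2 * (2 ^ l * l.factorial) ^ 2 / (2 * l + 1)) *
        ((l + m).factorial / (l - m).factorial) else 0 := by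
  set q : ℝ[X] := (X ^ 2 - 1) ^ m * rodrigues l' m with hq
  -- Either `i < m` and the factor `(X² - 1)^m` of `q` still vanishes at `±1`, or `j < l` and the
  -- derivative of `(X² - 1)^l` does.
  have hvan : ∀ t : ℝ, t ^ 2 = 1 → ∀ i j, i + j + 1 = l + m →
      (derivative^[j] ((X ^ 2 - 1 : ℝ[X]) ^ l) * derivative^[i] q).eval t = 0 := by
    intro t ht i j hij
    rw [eval_mul]
    by_cases hi : i < m
    · rw [eval_iterate_derivative_sq_sub_one (dvd_mul_right _ _) hi ht, mul_zero]
    · rw [eval_iterate_derivative_sq_sub_one dvd_rfl (show j < l by omega) ht, zero_mul]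
  have hdeg : q.natDegree ≤ l' + m := by
    refine natDegree_mul_le.trans ?_
    have := natDegree_rodrigues_le l' m
    rw [natDegree_sq_sub_one_pow]
    omega
  rw [rodrigues, integral_iterate_derivative_mul _ _ _ _ _ (hvan _ (by norm_num))
    (hvan _ (by norm_num)), iterate_derivative_of_natDegree_le (hdeg.trans (by omega))]
  simp only [eval_mul, eval_C]
  rw [intervalIntegral.integral_mul_const, integral_sq_sub_one_pow]
  split_ifs with h
  · subst h
    have hc : q.coeff (l + m) = (2 * l).factorial / (l - m).factorial := by
      rw [show l + m = 2 * m + (l - m) by omega, hq,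
        coeff_mul_add_eq_of_natDegree_le (natDegree_sq_sub_one_pow m).le (natDegree_rodrigues_le l m),
        coeff_sq_sub_one_pow, coeff_rodrigues hm, one_mul]
    rw [hc, Nat.factorial_succ (2 * l)]
    have h1 : ((-1 : ℝ)) ^ (l + m) * (-1) ^ l = (-1) ^ m := by
      rw [pow_add, mul_right_comm, ← mul_pow]; simp
    push_cast
    field_simp
    rw [show (2 : ℝ) ^ (2 * l + 1) = 2 * (2 ^ l) ^ 2 by rw [pow_succ, pow_mul']; ring, ← h1]
    ring
  · rw [coeff_eq_zero_of_natDegree_lt (by omega)]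
    simp

end Rodrigues

/-! ### The area measure: invariance under isometries and integrals of zonal polynomials -/

section Area

open Set
open scoped Pointwise

/-- Euclidean three-space. -/
abbrev E3 : Type := EuclideanSpace ℝ (Fin 3)

instance : IsFiniteMeasure area := by unfold area; infer_instance

/-- The action of a linear isometry on the sphere. -/
def sphereMap (A : E3 ≃ₗᵢ[ℝ] E3) (x : S2) : S2 := ⟨A x.1, by simp⟩

lemma continuous_sphereMap (A : E3 ≃ₗᵢ[ℝ] E3) : Continuous (sphereMap A) :=
  (A.continuous.comp continuous_subtype_val).subtype_mk _

/-- The area of a set is a multiple of the volume of the cone over it, and a linear isometry carries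
cones to cones and preserves volume. -/
lemma measurePreserving_sphereMap (A : E3 ≃ₗᵢ[ℝ] E3) :
    MeasurePreserving (sphereMap A) area area := by
  refine ⟨(continuous_sphereMap A).measurable, ?_⟩
  ext s hs
  rw [Measure.map_apply (continuous_sphereMap A).measurable hs, area,
    Measure.toSphere_apply' _ hs,
    Measure.toSphere_apply' _ ((continuous_sphereMap A).measurable hs)]
  congr 1
  have : Ioo (0 : ℝ) 1 • ((↑) '' (sphereMap A ⁻¹' s) : Set E3) =
      A ⁻¹' (Ioo (0 : ℝ) 1 • ((↑) '' s : Set E3)) := by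
    ext v
    simp only [mem_smul, mem_image, mem_preimage]
    constructor
    · rintro ⟨a, ha, _, ⟨x, hx, rfl⟩, rfl⟩
      exact ⟨a, ha, _, ⟨_, hx, rfl⟩, by simp [sphereMap]⟩
    · rintro ⟨a, ha, _, ⟨x, hx, rfl⟩, h⟩
      refine ⟨a, ha, _, ⟨sphereMap A.symm x, ?_, rfl⟩, ?_⟩
      · convert hx
        ext1
        simp [sphereMap]
      · apply A.injective
        simp [sphereMap, ← h]
  rw [this]
  exact A.measurePreserving.measure_preimage_equiv (f := A.toMeasurableEquiv) _

/-- The half-line Gaussian moment. -/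
def gaussMoment (k : ℕ) : ℝ := ∫ r in Ioi (0 : ℝ), r ^ k * Real.exp (-r ^ 2)

lemma gaussMoment_eq (k : ℕ) : gaussMoment k = 1 / 2 * Real.Gamma ((k + 1) / 2) := by
  rw [← integral_rpow_mul_exp_neg_rpow two_pos
    (show (-1 : ℝ) < k by linarith [(Nat.cast_nonneg k : (0 : ℝ) ≤ k)]), gaussMoment]
  simp

lemma gaussMoment_pos (k : ℕ) : 0 < gaussMoment k := by
  rw [gaussMoment_eq]
  have := Real.Gamma_pos_of_pos (show (0 : ℝ) < (k + 1) / 2 by positivity)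
  positivity

lemma gaussMoment_add_two (k : ℕ) : gaussMoment (k + 2) = (k + 1) / 2 * gaussMoment k := by
  rw [gaussMoment_eq, gaussMoment_eq]
  have : (((k + 2 : ℕ) : ℝ) + 1) / 2 = (k + 1) / 2 + 1 := by push_cast; ring
  rw [this, Real.Gamma_add_one (by positivity)]
  ring

lemma integral_pow_mul_gauss_even {k : ℕ} (hk : Even k) :
    ∫ t : ℝ, t ^ k * Real.exp (-t ^ 2) = 2 * gaussMoment k := by
  rw [gaussMoment, ← integral_comp_abs (f := fun t : ℝ => t ^ k * Real.exp (-t ^ 2))]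
  simp [hk.pow_abs]

lemma integral_pow_mul_gauss_odd {k : ℕ} (hk : Odd k) :
    ∫ t : ℝ, t ^ k * Real.exp (-t ^ 2) = 0 := by
  have h := integral_neg_eq_self (fun t : ℝ => t ^ k * Real.exp (-t ^ 2)) volume
  simp only [hk.neg_pow, neg_sq, neg_mul, integral_neg] at h
  linarith

/-- Fubini: the Gaussian is a product over the coordinates, and the two coordinates without a power
contribute `√π` each. -/
lemma integral_gauss_space (k : ℕ) :
    ∫ x : E3, x 2 ^ k * Real.exp (-‖x‖ ^ 2) =
      Real.pi * ∫ t : ℝ, t ^ k * Real.exp (-t ^ 2) := by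
  have h1 := (EuclideanSpace.volume_preserving_symm_measurableEquiv_toLp (Fin 3)).integral_comp'
    (fun x : Fin 3 → ℝ => ∏ i, (x i ^ (if i = 2 then k else 0) * Real.exp (-(x i) ^ 2)))
  rw [integral_fintype_prod_volume_eq_prod
    (fun (i : Fin 3) (t : ℝ) => t ^ (if i = 2 then k else 0) * Real.exp (-t ^ 2))] at h1
  have h2 : ∫ t : ℝ, Real.exp (-t ^ 2) = √Real.pi := by simpa using integral_gaussian 1
  simp only [Fin.prod_univ_three] at h1
  simp only [Fin.reduceEq, if_false, if_true, pow_zero, one_mul, h2,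
    Real.mul_self_sqrt Real.pi_pos.le] at h1
  rw [← h1]
  congr 1
  ext x
  rw [EuclideanSpace.norm_sq_eq, Fin.sum_univ_three]
  simp [Real.exp_add]
  ring

/-- The same integral in polar coordinates: the height scales as `r`, and the radial density `r²`
raises the exponent to `k + 2`. -/
lemma integral_gauss_polar (k : ℕ) :
    ∫ x : E3, x 2 ^ k * Real.exp (-‖x‖ ^ 2) =
      (∫ x : S2, x.1 2 ^ k ∂area) * gaussMoment (k + 2) := by
  have h1 : ∫ x : E3, x 2 ^ k * Real.exp (-‖x‖ ^ 2) =
      ∫ x : ({(0)}ᶜ : Set E3), x.1 2 ^ k * Real.exp (-‖x.1‖ ^ 2) ∂((volume : Measure E3).comap Subtype.val) := by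
    rw [integral_subtype_comap (measurableSet_singleton _).compl
      fun x : E3 ↦ x 2 ^ k * Real.exp (-‖x‖ ^ 2), restrict_compl_singleton]
  have h2 := (volume : Measure E3).measurePreserving_homeomorphUnitSphereProd.integral_comp
        (Homeomorph.measurableEmbedding _)
        (fun y : S2 × Ioi (0 : ℝ) => y.1.1 2 ^ k * (y.2.1 ^ k * Real.exp (-y.2.1 ^ 2)))
  rw [integral_prod_mul (fun y : S2 => y.1 2 ^ k)
    (fun r : Ioi (0 : ℝ) => (r.1 ^ k * Real.exp (-r.1 ^ 2)))] at h2
  rw [h1]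
  have h3 : ∫ r : Ioi (0 : ℝ), r.1 ^ k * Real.exp (-r.1 ^ 2)
      ∂(Measure.volumeIoiPow (Module.finrank ℝ E3 - 1)) = gaussMoment (k + 2) := by
    simp only [Measure.volumeIoiPow, ENNReal.ofReal, finrank_euclideanSpace, Fintype.card_fin]
    rw [integral_withDensity_eq_integral_smul,
      integral_subtype_comap measurableSet_Ioi
        fun a : ℝ ↦ Real.toNNReal (a ^ (3 - 1)) • (a ^ k * Real.exp (-a ^ 2)), gaussMoment,
        setIntegral_congr_fun measurableSet_Ioi fun x hx ↦ ?_]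
    · rw [NNReal.smul_def, Real.coe_toNNReal _ (pow_nonneg hx.out.le _), smul_eq_mul]
      ring
    · exact (measurable_subtype_coe.pow_const _).real_toNNReal
  rw [h3] at h2
  rw [area, ← h2]
  congr 1
  ext x
  have hx : ‖x.1‖ ≠ 0 := norm_ne_zero_iff.2 x.2
  simp only [homeomorphUnitSphereProd_apply_fst_coe, homeomorphUnitSphereProd_apply_snd_coe,
    PiLp.smul_apply, smul_eq_mul]
  rw [← mul_assoc, ← mul_pow]
  congr 2
  field_simp

/-- Comparing the Cartesian and polar values isolates the spherical moment, after division by a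
positive Gaussian moment. -/
lemma integral_coord_pow (k : ℕ) :
    ∫ x : S2, x.1 2 ^ k ∂area = 2 * Real.pi * ∫ t in (-1 : ℝ)..1, t ^ k := by
  have h1 := (integral_gauss_polar k).symm.trans (integral_gauss_space k)
  rw [integral_pow]
  rcases Nat.even_or_odd k with hk | hk
  · rw [integral_pow_mul_gauss_even hk, gaussMoment_add_two] at h1
    have h2 := gaussMoment_pos k
    have h3 : (k + 1 : ℝ) ≠ 0 := by positivity
    apply mul_right_cancel₀ (b := (k + 1) / 2 * gaussMoment k) (by positivity)
    rw [h1, hk.add_one.neg_one_pow]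
    field_simp
    norm_num
  · rw [integral_pow_mul_gauss_odd hk, mul_zero, mul_eq_zero] at h1
    rw [h1.resolve_right (gaussMoment_pos _).ne', hk.add_one.neg_one_pow]
    simp

lemma continuous_coord (i : Fin 3) : Continuous fun x : S2 => x.1 i :=
  (EuclideanSpace.proj (𝕜 := ℝ) i).continuous.comp continuous_subtype_val

lemma integrable_of_continuous {F : Type*} [NormedAddCommGroup F] {g : S2 → F}
    (hg : Continuous g) : Integrable g area :=
  hg.integrable_of_hasCompactSupport (HasCompactSupport.of_compactSpace _)

/-- Archimedes' hat-box theorem for polynomials of the height. -/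
lemma integral_zonal (p : Polynomial ℝ) :
    ∫ x : S2, p.eval (x.1 2) ∂area = 2 * Real.pi * ∫ t in (-1 : ℝ)..1, p.eval t := by
  induction p using Polynomial.induction_on' with
  | add p q hp hq =>
    simp only [Polynomial.eval_add]
    have h (p : Polynomial ℝ) : Integrable (fun x : S2 => p.eval (x.1 2)) area :=
      integrable_of_continuous (p.continuous.comp (continuous_coord 2))
    rw [intervalIntegral.integral_add (intervalIntegrable_eval _ _ _)
      (intervalIntegrable_eval _ _ _), integral_add (h p) (h q), hp, hq]
    ring
  | monomial k a =>
    simp only [Polynomial.eval_monomial]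
    rw [intervalIntegral.integral_const_mul, integral_const_mul, integral_coord_pow]
    ring

end Area

/-! ### Rotations and the reflection as isometries -/

section Isometries

/-- Build a linear isometry of Euclidean three-space from a norm-preserving linear map. -/
def isoOfNorm (f : E3 →ₗ[ℝ] E3) (hf : ∀ x, ‖f x‖ ^ 2 = ‖x‖ ^ 2) : E3 ≃ₗᵢ[ℝ] E3 :=
  LinearIsometry.toLinearIsometryEquiv
    ⟨f, fun x => by simpa using hf x⟩ rfl

/-- Rotation about the `z`-axis as a linear isometry. -/
def rotZIso (a : ℝ) : E3 ≃ₗᵢ[ℝ] E3 :=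
  isoOfNorm
    { toFun := fun x => !₂[Real.cos a * x 0 - Real.sin a * x 1,
        Real.sin a * x 0 + Real.cos a * x 1, x 2]
      map_add' := fun x y => by ext i; fin_cases i <;> simp <;> ring
      map_smul' := fun c x => by ext i; fin_cases i <;> simp <;> ring }
    fun x => by
      simp only [EuclideanSpace.norm_sq_eq, Fin.sum_univ_three, Real.norm_eq_abs, sq_abs]
      simp
      linear_combination (x 0 ^ 2 + x 1 ^ 2) * Real.sin_sq_add_cos_sq a

/-- Rotation about the `y`-axis as a linear isometry. -/
def rotYIso (a : ℝ) : E3 ≃ₗᵢ[ℝ] E3 :=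
  isoOfNorm
    { toFun := fun x => !₂[Real.cos a * x 0 + Real.sin a * x 2, x 1,
        -Real.sin a * x 0 + Real.cos a * x 2]
      map_add' := fun x y => by ext i; fin_cases i <;> simp <;> ring
      map_smul' := fun c x => by ext i; fin_cases i <;> simp <;> ring }
    fun x => by
      simp only [EuclideanSpace.norm_sq_eq, Fin.sum_univ_three, Real.norm_eq_abs, sq_abs]
      simp
      linear_combination (x 0 ^ 2 + x 2 ^ 2) * Real.sin_sq_add_cos_sq a

/-- The reflection in the `xz`-plane as a linear isometry. -/
def reflIso : E3 ≃ₗᵢ[ℝ] E3 :=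
  isoOfNorm
    { toFun := fun x => !₂[x 0, -x 1, x 2]
      map_add' := fun x y => by ext i; fin_cases i <;> simp [add_comm]
      map_smul' := fun c x => by ext i; fin_cases i <;> simp }
    fun x => by
      simp only [EuclideanSpace.norm_sq_eq, Fin.sum_univ_three, Real.norm_eq_abs, sq_abs]
      simp

lemma sphereMap_rotZIso (a : ℝ) : sphereMap (rotZIso a) = rotZ a := rfl

lemma integral_comp_sphereMap {F : Type*} [NormedAddCommGroup F] [NormedSpace ℝ F]
    (A : E3 ≃ₗᵢ[ℝ] E3) (g : S2 → F) : ∫ x, g (sphereMap A x) ∂area = ∫ x, g x ∂area := by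
  refine (measurePreserving_sphereMap A).integral_comp ?_ g
  have hinj : Function.Injective (sphereMap A) := fun x y h => by
    have h' := congrArg Subtype.val h
    exact Subtype.ext (A.injective h')
  exact ((continuous_sphereMap A).isClosedEmbedding hinj).measurableEmbedding

end Isometries

/-! ### Spherical harmonics in Cartesian coordinates -/

section Cartesian

/-- The complex number `x + iy` attached to a point of the sphere. -/
def planar (x : S2) : ℂ := ⟨x.1 0, x.1 1⟩

lemma continuous_planar : Continuous planar := by
  have : planar = fun x : S2 => (x.1 0 : ℂ) + (x.1 1 : ℂ) * Complex.I := by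
    ext x
    exact (Complex.mk_eq_add_mul_I _ _)
  rw [this]
  have h0 := continuous_coord 0
  have h1 := continuous_coord 1
  fun_prop

lemma normSq_planar (x : S2) : Complex.normSq (planar x) = 1 - x.1 2 ^ 2 := by
  rw [Complex.normSq_apply, planar]
  linear_combination norm_sq_coord x

lemma planar_mul_conj (x : S2) : planar x * conj (planar x) = 1 - (x.1 2 : ℂ) ^ 2 := by
  rw [Complex.mul_conj, normSq_planar]
  push_cast
  ring

lemma norm_planar (x : S2) : ‖planar x‖ = √(1 - x.1 2 ^ 2) := by
  rw [← normSq_planar, Complex.normSq_eq_norm_sq, Real.sqrt_sq (norm_nonneg _)]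

lemma sqrt_pow_mul_exp (x : S2) (m : ℕ) :
    ((√(1 - x.1 2 ^ 2) ^ m : ℝ) : ℂ) * Complex.exp (Complex.I * m * longitude x) =
      planar x ^ m := by
  have h := Complex.norm_mul_exp_arg_mul_I (planar x)
  conv_rhs => rw [← h]
  rw [mul_pow, ← Complex.exp_nat_mul, norm_planar, longitude, planar]
  push_cast
  congr 2
  ring

lemma cos_colatitude (x : S2) : Real.cos (colatitude x) = x.1 2 := by
  have h := norm_sq_coord x
  exact Real.cos_arccos (by nlinarith [sq_nonneg (x.1 0), sq_nonneg (x.1 1)])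
    (by nlinarith [sq_nonneg (x.1 0), sq_nonneg (x.1 1)])

/-- `(x + iy)^m` for `m ≥ 0` and `(x - iy)^|m|` for `m < 0`. -/
def planarPow (m : ℤ) (x : S2) : ℂ :=
  if 0 ≤ m then planar x ^ m.natAbs else conj (planar x) ^ m.natAbs

/-- The constant in the Cartesian form of the spherical harmonics. -/
def harmConst (l : ℕ) (m : ℤ) : ℝ :=
  (if 0 ≤ m then 1 else (-1) ^ m.natAbs) *
    (normFactor l m.natAbs * ((-1) ^ m.natAbs / (2 ^ l * l.factorial)))

/-- Absorbs the factorial ratio in the Legendre function of negative order, so that the orders `±m`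
share one constant up to sign. -/
lemma normFactor_neg {l m : ℕ} (h : m ≤ l) :
    normFactor l (-m) * (((l - m).factorial : ℝ) / ((l + m).factorial : ℝ)) =
      normFactor l m := by
  have e1 : ((l : ℤ) - (-(m : ℤ))).toNat = l + m := by omega
  have e2 : ((l : ℤ) + (-(m : ℤ))).toNat = l - m := by omega
  have e3 : ((l : ℤ) - (m : ℤ)).toNat = l - m := by omega
  have e4 : ((l : ℤ) + (m : ℤ)).toNat = l + m := by omega
  rw [normFactor, normFactor, e1, e2, e3, e4]
  have hp : (0 : ℝ) ≤ ((l - m).factorial : ℝ) / ((l + m).factorial : ℝ) := by positivity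
  refine ((Real.sqrt_eq_iff_mul_self_eq (by positivity) (by positivity)).2 ?_).symm
  rw [mul_mul_mul_comm, Real.mul_self_sqrt (by positivity)]
  field_simp

lemma sphHarm_eq {l : ℕ} {m : ℤ} (h : m.natAbs ≤ l) (x : S2) :
    sphHarm l m x =
      harmConst l m * ((rodrigues l m.natAbs).eval (x.1 2) : ℝ) * planarPow m x := by
  obtain ⟨k, rfl | rfl⟩ := m.eq_nat_or_neg
  · have := sqrt_pow_mul_exp x k
    simp only [sphHarm, legendre, harmConst, planarPow, cos_colatitude, legendreNonneg,
      Int.natCast_nonneg, if_true, Int.natAbs_natCast, rodrigues]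
    rw [← this]
    push_cast
    ring
  · rcases Nat.eq_zero_or_pos k with rfl | hk
    · simp [sphHarm, legendre, harmConst, planarPow, cos_colatitude, legendreNonneg, rodrigues]
      ring
    have hneg : ¬ (0 : ℤ) ≤ -(k : ℤ) := by omega
    simp only [Int.natAbs_neg, Int.natAbs_natCast] at h
    have h2 : ((√(1 - x.1 2 ^ 2) ^ k : ℝ) : ℂ) *
        Complex.exp (Complex.I * ((-(k : ℤ) : ℤ) : ℂ) * longitude x) = conj (planar x) ^ k := by
      rw [← map_pow, ← sqrt_pow_mul_exp x k, map_mul, Complex.conj_ofReal, ← Complex.exp_conj]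
      simp
    simp only [sphHarm, legendre, harmConst, planarPow, cos_colatitude, legendreNonneg,
      hneg, if_false, Int.natAbs_natCast, Int.natAbs_neg, rodrigues]
    rw [← normFactor_neg h, ← h2]
    push_cast
    ring

lemma continuous_planarPow (m : ℤ) : Continuous (planarPow m) := by
  unfold planarPow
  have := continuous_planar
  split_ifs
  · fun_prop
  · exact (Complex.continuous_conj.comp this).pow _

lemma planarPow_mul_conj (m : ℤ) (x : S2) :
    planarPow m x * conj (planarPow m x) = ((1 - x.1 2 ^ 2 : ℝ) : ℂ) ^ m.natAbs := by
  unfold planarPow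
  push_cast
  split_ifs
  · rw [map_pow, ← mul_pow, planar_mul_conj]
  · rw [map_pow, Complex.conj_conj, ← mul_pow, mul_comm, planar_mul_conj]

lemma planar_rotZ (a : ℝ) (x : S2) :
    planar (rotZ a x) = Complex.exp (Complex.I * a) * planar x := by
  rw [mul_comm Complex.I, Complex.exp_mul_I, ← Complex.ofReal_cos, ← Complex.ofReal_sin]
  apply Complex.ext
  · simp [planar, rotZ, -Complex.ofReal_cos, -Complex.ofReal_sin]
  · simp [planar, rotZ, -Complex.ofReal_cos, -Complex.ofReal_sin]
    ring

lemma planarPow_rotZ (m : ℤ) (a : ℝ) (x : S2) :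
    planarPow m (rotZ a x) = Complex.exp (Complex.I * m * a) * planarPow m x := by
  obtain ⟨k, rfl | rfl⟩ := m.eq_nat_or_neg
  · simp only [planarPow, Int.natCast_nonneg, if_true, Int.natAbs_natCast]
    rw [planar_rotZ, mul_pow, ← Complex.exp_nat_mul]
    congr 2
    push_cast
    ring
  · rcases Nat.eq_zero_or_pos k with rfl | hk
    · simp [planarPow]
    have hneg : ¬ (0 : ℤ) ≤ -(k : ℤ) := by omega
    simp only [planarPow, hneg, if_false, Int.natAbs_natCast, Int.natAbs_neg]
    rw [planar_rotZ, map_mul, mul_pow, ← Complex.exp_conj, ← Complex.exp_nat_mul]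
    congr 2
    simp
    ring

lemma harmConst_sq {l : ℕ} {m : ℤ} (h : m.natAbs ≤ l) :
    harmConst l m ^ 2 * (2 * Real.pi * (2 * (2 ^ l * l.factorial) ^ 2 / (2 * l + 1) *
      ((l + m.natAbs).factorial / (l - m.natAbs).factorial))) = 1 := by
  have e3 : ((l : ℤ) - (m.natAbs : ℤ)).toNat = l - m.natAbs := by omega
  have e4 : ((l : ℤ) + (m.natAbs : ℤ)).toNat = l + m.natAbs := by omega
  have hs : (if 0 ≤ m then (1 : ℝ) else (-1) ^ m.natAbs) ^ 2 = 1 := by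
    split_ifs
    · simp
    · rw [← pow_mul, mul_comm, pow_mul]; simp
  have hs' : ((-1 : ℝ) ^ m.natAbs) ^ 2 = 1 := by rw [← pow_mul, mul_comm, pow_mul]; simp
  rw [harmConst, mul_pow, hs, one_mul, mul_pow, div_pow, hs', normFactor, e3, e4,
    Real.sq_sqrt (by positivity)]
  have := Real.pi_ne_zero
  field_simp
  ring

lemma harmConst_ne_zero {l : ℕ} {m : ℤ} (h : m.natAbs ≤ l) : harmConst l m ≠ 0 := by
  intro h0
  have := harmConst_sq h
  simp [h0] at this

lemma integral_sphHarm_mul_conj {l l' : ℕ} {m m' : ℤ} (h : m.natAbs ≤ l) (h' : m'.natAbs ≤ l') :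
    ∫ x, sphHarm l m x * conj (sphHarm l' m' x) ∂area = if l = l' ∧ m = m' then 1 else 0 := by
  by_cases hm : m = m'
  · subst hm
    wlog hl : l' ≤ l generalizing l l'
    · have h1 := this h' h (by omega)
      have h2 : ∫ x, sphHarm l m x * conj (sphHarm l' m x) ∂area =
          conj (∫ x, sphHarm l' m x * conj (sphHarm l m x) ∂area) := by
        rw [← integral_conj]
        simp [mul_comm]
      rw [h2, h1]
      simp [eq_comm]
    have h1 : ∀ x : S2, sphHarm l m x * conj (sphHarm l' m x) =
        ((harmConst l m * harmConst l' m * (-1) ^ m.natAbs * (rodrigues l m.natAbs *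
          ((Polynomial.X ^ 2 - 1) ^ m.natAbs * rodrigues l' m.natAbs)).eval (x.1 2) : ℝ) : ℂ) := by
      intro x
      have h2 := planarPow_mul_conj m x
      have h3 : ((1 - x.1 2 ^ 2 : ℝ) : ℂ) ^ m.natAbs =
          (-1) ^ m.natAbs * ((x.1 2 : ℂ) ^ 2 - 1) ^ m.natAbs := by
        rw [← mul_pow]
        congr 1
        push_cast
        ring
      rw [h3] at h2
      rw [sphHarm_eq h, sphHarm_eq h']
      simp only [map_mul, Complex.conj_ofReal, Polynomial.eval_mul, Polynomial.eval_pow,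
        Polynomial.eval_sub, Polynomial.eval_X, Polynomial.eval_one]
      push_cast
      linear_combination (harmConst l m : ℂ) * harmConst l' m *
        ((rodrigues l m.natAbs).eval (x.1 2) : ℝ) * ((rodrigues l' m.natAbs).eval (x.1 2) : ℝ) * h2
    simp only [h1]
    rw [integral_complex_ofReal, integral_const_mul, integral_zonal, integral_rodrigues_mul _ _ _ hl h']
    by_cases hll : l = l'
    · subst hll
      have h4 := harmConst_sq h
      have hs' : (-1 : ℝ) ^ m.natAbs * (-1) ^ m.natAbs = 1 := by rw [← mul_pow]; simp
      simp only [and_self, if_true]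
      norm_cast
      push_cast
      linear_combination h4 + harmConst l m ^ 2 *
        (2 * Real.pi * (2 * (2 ^ l * l.factorial) ^ 2 / (2 * l + 1) *
          ((l + m.natAbs).factorial / (l - m.natAbs).factorial))) * hs'
    · simp [hll]
  · simp only [hm, and_false, if_false]
    have hne : ((m : ℂ) - m') ≠ 0 := by
      rw [sub_ne_zero]
      exact_mod_cast hm
    -- Rotation by `a` multiplies the integrand by `exp(i(m - m')a)`; this angle makes the factor
    -- `-1`, so the integral equals its own negative.
    have h1 := integral_comp_sphereMap (rotZIso (Real.pi / (m - m')))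
      (fun x => sphHarm l m x * conj (sphHarm l' m' x))
    rw [sphereMap_rotZIso] at h1
    have h2 : ∀ x : S2, sphHarm l m (rotZ (Real.pi / (m - m')) x) *
        conj (sphHarm l' m' (rotZ (Real.pi / (m - m')) x)) =
        -(sphHarm l m x * conj (sphHarm l' m' x)) := by
      intro x
      have h3 : Complex.exp (Complex.I * m * ((Real.pi / (m - m') : ℝ) : ℂ)) *
          conj (Complex.exp (Complex.I * m' * ((Real.pi / (m - m') : ℝ) : ℂ))) = -1 := by
        rw [← Complex.exp_conj, ← Complex.exp_add, ← Complex.exp_pi_mul_I]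
        congr 1
        simp
        field_simp
        ring
      rw [sphHarm_eq h, sphHarm_eq h', sphHarm_eq h, sphHarm_eq h', planarPow_rotZ,
        planarPow_rotZ]
      simp only [map_mul, Complex.conj_ofReal]
      have h5 : (rotZ (Real.pi / (m - m')) x).1 2 = x.1 2 := rfl
      rw [h5]
      linear_combination ((harmConst l m : ℂ) * harmConst l' m' *
        ((rodrigues l m.natAbs).eval (x.1 2) : ℝ) * ((rodrigues l' m'.natAbs).eval (x.1 2) : ℝ) *
        planarPow m x * conj (planarPow m' x)) * h3
    simp only [h2, integral_neg] at h1
    exact self_eq_neg.1 h1.symm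

end Cartesian

/-! ### The single index -/

section Index

lemma deg_sq_le (n : ℕ) : deg n * deg n ≤ n := Nat.sqrt_le n

lemma le_deg_sq_add (n : ℕ) : n ≤ deg n * deg n + deg n + deg n := Nat.sqrt_le_add n

lemma natAbs_ord_le (n : ℕ) : (ord n).natAbs ≤ deg n := by
  have h1 := deg_sq_le n
  have h2 := le_deg_sq_add n
  unfold ord
  zify at h1 h2
  have : (deg n : ℤ) * (deg n + 1) = deg n * deg n + deg n := by ring
  omega

lemma idx_cast {l : ℕ} {m : ℤ} (h : m.natAbs ≤ l) : (idx l m : ℤ) = (l : ℤ) * l + l + m := by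
  unfold idx
  rw [Int.toNat_of_nonneg]
  · ring
  · nlinarith [show -(l : ℤ) ≤ m by omega, sq_nonneg (l : ℤ)]

lemma deg_idx {l : ℕ} {m : ℤ} (h : m.natAbs ≤ l) : deg (idx l m) = l := by
  have h1 := idx_cast h
  unfold deg
  symm
  rw [Nat.eq_sqrt]
  have e : (l + 1) * (l + 1) = l * l + l + l + 1 := by ring
  rw [e]
  have e2 : ((l * l : ℕ) : ℤ) = (l : ℤ) * l := by push_cast; rfl
  constructor <;> omega

lemma ord_idx {l : ℕ} {m : ℤ} (h : m.natAbs ≤ l) : ord (idx l m) = m := by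
  have h1 := idx_cast h
  unfold ord
  rw [deg_idx h, h1]
  ring

lemma idx_deg_ord (n : ℕ) : idx (deg n) (ord n) = n := by
  have h1 := idx_cast (natAbs_ord_le n)
  unfold ord at h1
  zify
  unfold ord
  rw [h1]
  ring

lemma deg_le_iff (n L : ℕ) : deg n ≤ L ↔ n < (L + 1) ^ 2 := by
  rw [deg, ← Nat.lt_succ_iff, Nat.sqrt_lt', Nat.succ_eq_add_one]

lemma Y_idx {l : ℕ} {m : ℤ} (h : m.natAbs ≤ l) : Y (idx l m) = sphHarm l m := by
  ext x
  rw [Y, deg_idx h, ord_idx h]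

lemma Y_eq (n : ℕ) (x : S2) : Y n x = harmConst (deg n) (ord n) *
    ((rodrigues (deg n) (ord n).natAbs).eval (x.1 2) : ℝ) * planarPow (ord n) x :=
  sphHarm_eq (natAbs_ord_le n) x

lemma continuous_Y (n : ℕ) : Continuous (Y n) := by
  rw [show Y n = _ from funext (Y_eq n)]
  have h1 := continuous_planarPow (ord n)
  have h2 := (rodrigues (deg n) (ord n).natAbs).continuous.comp (continuous_coord 2)
  exact (continuous_const.mul (Complex.continuous_ofReal.comp h2)).mul h1

lemma integral_Y_mul_conj (n k : ℕ) :
    ∫ x, Y n x * conj (Y k x) ∂area = if n = k then 1 else 0 := by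
  have h := integral_sphHarm_mul_conj (natAbs_ord_le n) (natAbs_ord_le k)
  have h2 : (deg n = deg k ∧ ord n = ord k) ↔ n = k :=
    ⟨fun ⟨h1, h2⟩ => by rw [← idx_deg_ord n, ← idx_deg_ord k, h1, h2], by rintro rfl; simp⟩
  simp only [h2] at h
  exact h

/-- The index of the order-reversed spherical harmonic. -/
def negIdx (r : ℕ) : ℕ := idx (deg r) (-ord r)

lemma conj_Y (r : ℕ) (x : S2) : conj (Y r x) = (-1) ^ (ord r).natAbs * Y (negIdx r) x := by
  have h := natAbs_ord_le r
  have h' : (-ord r).natAbs ≤ deg r := by simpa using h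
  rw [Y_eq, negIdx, Y_idx h', sphHarm_eq h']
  simp only [map_mul, Complex.conj_ofReal, harmConst, planarPow, Int.natAbs_neg]
  have hs' : (-1 : ℂ) ^ (ord r).natAbs * (-1) ^ (ord r).natAbs = 1 := by rw [← mul_pow]; simp
  rcases lt_trichotomy (ord r) 0 with h0 | h0 | h0
  · have h1 : ¬ (0 ≤ ord r) := by omega
    have h2 : 0 ≤ -ord r := by omega
    simp only [h1, h2, if_true, if_false, map_pow, Complex.conj_conj]
    push_cast
    ring
  · simp [h0]
  · have h1 : (0 ≤ ord r) := by omega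
    have h2 : ¬ 0 ≤ -ord r := by omega
    simp only [h1, h2, if_true, if_false, map_pow]
    simp only [Complex.ofReal_mul, Complex.ofReal_div, Complex.ofReal_pow, Complex.ofReal_neg,
      Complex.ofReal_one, Complex.ofReal_natCast, Complex.ofReal_ofNat]
    linear_combination -(normFactor (deg r) (ord r).natAbs : ℂ) *
      ((-1) ^ (ord r).natAbs / (2 ^ deg r * (deg r).factorial)) *
      ((rodrigues (deg r) (ord r).natAbs).eval (x.1 2) : ℝ) *
      (starRingEnd ℂ) (planar x) ^ (ord r).natAbs * hs'

end Index

/-! ### Polynomial functions on the sphere are spanned by spherical harmonics -/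

section Polynomials

open Submodule

/-- The coordinates as complex functions on the sphere. -/
def coordFun (i : Fin 3) (x : S2) : ℂ := (x.1 i : ℂ)

/-- Affine functions on the sphere. -/
def affineSpan : Submodule ℂ (S2 → ℂ) := span ℂ (insert 1 (Set.range coordFun))

/-- The span of the spherical harmonics of degree at most `l`. -/
def harmSpan (l : ℕ) : Submodule ℂ (S2 → ℂ) := span ℂ (Y '' {n | deg n ≤ l})

/-- The span of the functions `(x ± iy)^m z^k` with `m + k ≤ l`. -/
def cylSpan (l : ℕ) : Submodule ℂ (S2 → ℂ) :=
  span ℂ {g | ∃ (m : ℤ) (k : ℕ), m.natAbs + k ≤ l ∧ g = fun x => planarPow m x * coordFun 2 x ^ k}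

lemma one_mem_affineSpan : (1 : S2 → ℂ) ∈ affineSpan := subset_span (by simp)

lemma coordFun_mem_affineSpan (i : Fin 3) : coordFun i ∈ affineSpan := subset_span (by simp)

lemma affineSpan_pow_mono {l l' : ℕ} (h : l ≤ l') : affineSpan ^ l ≤ affineSpan ^ l' := by
  obtain ⟨k, rfl⟩ := Nat.exists_eq_add_of_le h
  induction k with
  | zero => exact le_rfl
  | succ k ih =>
    refine (ih (by omega)).trans ?_
    rw [← add_assoc, pow_succ]
    intro f hf
    simpa using mul_mem_mul hf one_mem_affineSpan

lemma planar_eq : planar = coordFun 0 + Complex.I • coordFun 1 := by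
  ext x
  simp only [planar, coordFun, Pi.add_apply, Pi.smul_apply, smul_eq_mul]
  rw [Complex.mk_eq_add_mul_I, mul_comm Complex.I]

lemma conj_planar_eq : (fun x => conj (planar x)) = coordFun 0 - Complex.I • coordFun 1 := by
  ext x
  simp [planar_eq, coordFun, sub_eq_add_neg]

lemma planarPow_mem (m : ℤ) : planarPow m ∈ affineSpan ^ m.natAbs := by
  by_cases h : 0 ≤ m
  · have : planarPow m = planar ^ m.natAbs := by ext x; simp [planarPow, h]
    rw [this, planar_eq]
    exact pow_mem_pow _ (add_mem (coordFun_mem_affineSpan _)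
      (smul_mem _ _ (coordFun_mem_affineSpan _))) _
  · have : planarPow m = (fun x => conj (planar x)) ^ m.natAbs := by ext x; simp [planarPow, h]
    rw [this, conj_planar_eq]
    exact pow_mem_pow _ (sub_mem (coordFun_mem_affineSpan _)
      (smul_mem _ _ (coordFun_mem_affineSpan _))) _

lemma zonal_mem {p : Polynomial ℝ} {k : ℕ} (h : p.natDegree ≤ k) :
    (fun x : S2 => ((p.eval (x.1 2) : ℝ) : ℂ)) ∈ affineSpan ^ k := by
  have : (fun x : S2 => ((p.eval (x.1 2) : ℝ) : ℂ)) =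
      ∑ i ∈ Finset.range (p.natDegree + 1), (p.coeff i : ℂ) • coordFun 2 ^ i := by
    ext x
    rw [Polynomial.eval_eq_sum_range]
    simp [coordFun]
  rw [this]
  refine sum_mem fun i hi => smul_mem _ _ ?_
  refine affineSpan_pow_mono (l := i) ?_ (pow_mem_pow _ (coordFun_mem_affineSpan _) _)
  have := Finset.mem_range.1 hi
  omega

lemma Y_mem_affineSpan_pow (n : ℕ) : Y n ∈ affineSpan ^ deg n := by
  have h1 := mul_mem_mul (planarPow_mem (ord n))
    (zonal_mem (natDegree_rodrigues_le (deg n) (ord n).natAbs))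
  rw [← pow_add, Nat.add_sub_cancel' (natAbs_ord_le n)] at h1
  have h2 : Y n = (harmConst (deg n) (ord n) : ℂ) • (planarPow (ord n) *
      fun x : S2 => (((rodrigues (deg n) (ord n).natAbs).eval (x.1 2) : ℝ) : ℂ)) := by
    ext x
    rw [Y_eq]
    simp only [Pi.smul_apply, Pi.mul_apply, smul_eq_mul]
    ring
  rw [h2]
  exact smul_mem _ _ h1

lemma harmSpan_le (l : ℕ) : harmSpan l ≤ affineSpan ^ l := by
  rw [harmSpan, span_le]
  rintro _ ⟨n, hn, rfl⟩
  exact affineSpan_pow_mono hn (Y_mem_affineSpan_pow n)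

lemma planarPow_neg (m : ℤ) (x : S2) : planarPow (-m) x = conj (planarPow m x) := by
  unfold planarPow
  rcases lt_trichotomy m 0 with h | h | h
  · simp [h.le, not_le.2 h]
  · simp [h]
  · simp [h.le, not_le.2 h]

lemma planar_mul_planarPow {m : ℤ} (h : 0 ≤ m) (x : S2) :
    planar x * planarPow m x = planarPow (m + 1) x := by
  have h1 : (m + 1).natAbs = m.natAbs + 1 := by omega
  simp [planarPow, h, show 0 ≤ m + 1 by omega, h1, pow_succ']

lemma planar_mul_planarPow_neg {m : ℤ} (h : m < 0) (x : S2) :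
    planar x * planarPow m x = (1 - coordFun 2 x ^ 2) * planarPow (m + 1) x := by
  have h1 : m.natAbs = (m + 1).natAbs + 1 := by omega
  have h2 : planarPow (m + 1) x = conj (planar x) ^ (m + 1).natAbs := by
    unfold planarPow
    split_ifs with h3
    · have : m + 1 = 0 := by omega
      simp [this]
    · rfl
  rw [h2, planarPow, if_neg (not_le.2 h), h1, pow_succ', ← mul_assoc, planar_mul_conj]
  rfl

lemma cylSpan_gen {m : ℤ} {k l : ℕ} (h : m.natAbs + k ≤ l) :
    (fun x => planarPow m x * coordFun 2 x ^ k) ∈ cylSpan l :=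
  subset_span ⟨m, k, h, rfl⟩

/-- For `m ≥ 0` the order simply rises. For `m < 0` one conjugate factor is consumed through `(x +
iy)(x - iy) = 1 - z²`, which trades it for at most two powers of `z`. -/
lemma planar_mul_mem_cylSpan {m : ℤ} {k l : ℕ} (h : m.natAbs + k ≤ l) :
    (fun x => planar x * (planarPow m x * coordFun 2 x ^ k)) ∈ cylSpan (l + 1) := by
  by_cases hm : 0 ≤ m
  · convert cylSpan_gen (m := m + 1) (k := k) (l := l + 1) (by omega) using 2
    rw [← planar_mul_planarPow hm]
    ring
  · have h1 := cylSpan_gen (m := m + 1) (k := k) (l := l + 1) (by omega)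
    have h2 := cylSpan_gen (m := m + 1) (k := k + 2) (l := l + 1) (by omega)
    convert sub_mem h1 h2 using 1
    ext x
    rw [← mul_assoc, planar_mul_planarPow_neg (not_le.1 hm)]
    simp only [Pi.sub_apply]
    ring

lemma conj_coordFun (i : Fin 3) (x : S2) : conj (coordFun i x) = coordFun i x := by
  simp [coordFun]

lemma conj_mem_cylSpan {l : ℕ} {g : S2 → ℂ} (hg : g ∈ cylSpan l) :
    (fun x => conj (g x)) ∈ cylSpan l := by
  refine span_induction (p := fun g _ => (fun x => conj (g x)) ∈ cylSpan l) ?_ ?_ ?_ ?_ hg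
  · rintro _ ⟨m, k, h, rfl⟩
    convert cylSpan_gen (m := -m) (k := k) (l := l) (by omega) using 2
    rw [map_mul, map_pow, conj_coordFun, planarPow_neg]
  · simp only [Pi.zero_apply, map_zero]
    exact zero_mem (cylSpan l)
  · intro f g _ _ hf hg
    convert add_mem hf hg using 1
    ext x
    simp
  · intro a f _ hf
    convert smul_mem _ (conj a) hf using 1
    ext x
    simp

lemma conj_planar_mul_mem_cylSpan {m : ℤ} {k l : ℕ} (h : m.natAbs + k ≤ l) :
    (fun x => conj (planar x) * (planarPow m x * coordFun 2 x ^ k)) ∈ cylSpan (l + 1) := by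
  convert conj_mem_cylSpan (planar_mul_mem_cylSpan (m := -m) (k := k) (l := l) (by omega)) using 2
  rw [map_mul, map_mul, map_pow, conj_coordFun, planarPow_neg, Complex.conj_conj]

/-- Passes from the generators `x, y` to `x ± iy`, which act well on the generators of `cylSpan`. -/
lemma affineSpan_le : affineSpan ≤
    span ℂ {1, planar, (fun x => conj (planar x)), coordFun 2} := by
  rw [affineSpan, span_le]
  rintro f (rfl | ⟨i, rfl⟩)
  · exact subset_span (by simp)
  have h1 : planar ∈ span ℂ ({1, planar, (fun x => conj (planar x)), coordFun 2} :
    Set (S2 → ℂ)) := subset_span (by simp)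
  have h2 : (fun x => conj (planar x)) ∈ span ℂ ({1, planar, (fun x => conj (planar x)),
    coordFun 2} : Set (S2 → ℂ)) := subset_span (by simp)
  have h3 : coordFun 2 ∈ span ℂ ({1, planar, (fun x => conj (planar x)),
    coordFun 2} : Set (S2 → ℂ)) := subset_span (by simp)
  rw [SetLike.mem_coe]
  fin_cases i
  · convert smul_mem _ (1 / 2 : ℂ) (add_mem h1 h2) using 1
    rw [conj_planar_eq, planar_eq]
    simp only [Fin.zero_eta]
    module
  · convert smul_mem _ (-Complex.I / 2 : ℂ) (sub_mem h1 h2) using 1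
    rw [conj_planar_eq, planar_eq]
    ext x
    simp only [Fin.mk_one, Pi.smul_apply, Pi.sub_apply, Pi.add_apply, smul_eq_mul]
    linear_combination coordFun 1 x * Complex.I_mul_I
  · exact h3

lemma cylSpan_mono {l l' : ℕ} (h : l ≤ l') : cylSpan l ≤ cylSpan l' :=
  span_mono fun _ ⟨m, k, h1, h2⟩ => ⟨m, k, h1.trans h, h2⟩

lemma affineSpan_mul_cylSpan (l : ℕ) : affineSpan * cylSpan l ≤ cylSpan (l + 1) := by
  refine (mul_le_mul_left affineSpan_le _).trans ?_
  rw [cylSpan, span_mul_span, span_le]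
  rintro _ ⟨f, hf, _, ⟨m, k, h, rfl⟩, rfl⟩
  simp only [Set.mem_insert_iff, Set.mem_singleton_iff] at hf
  rcases hf with rfl | rfl | rfl | rfl
  · simpa using cylSpan_mono (Nat.le_succ l) (cylSpan_gen h)
  · exact planar_mul_mem_cylSpan h
  · exact conj_planar_mul_mem_cylSpan h
  · rw [SetLike.mem_coe]
    convert cylSpan_gen (m := m) (k := k + 1) (l := l + 1) (by omega) using 1
    ext x
    simp only [Pi.mul_apply]
    ring

lemma affineSpan_pow_le_cylSpan (l : ℕ) : affineSpan ^ l ≤ cylSpan l := by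
  induction l with
  | zero =>
    rw [pow_zero, one_eq_span, span_le]
    rw [Set.singleton_subset_iff, SetLike.mem_coe]
    convert cylSpan_gen (m := 0) (k := 0) (l := 0) (by simp) using 1
    ext x
    simp [planarPow]
  | succ l ih =>
    rw [pow_succ']
    exact (mul_le_mul_right ih _).trans (affineSpan_mul_cylSpan l)

/-- Triangularity: for fixed order, the Rodrigues polynomials realise every degree in `z`, so the
top coefficient of `p` can be removed by subtracting a multiple of one harmonic. -/
lemma planarPow_mul_zonal_mem {m : ℤ} {k l : ℕ} (h : m.natAbs + k ≤ l + 1) (p : Polynomial ℝ)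
    (hp : ∀ j, k ≤ j → p.coeff j = 0) :
    (fun x : S2 => planarPow m x * ((p.eval (x.1 2) : ℝ) : ℂ)) ∈ harmSpan l := by
  induction k generalizing p with
  | zero =>
    have : p = 0 := by ext j; simpa using hp j (Nat.zero_le _)
    simp only [this, Polynomial.eval_zero, Complex.ofReal_zero, mul_zero]
    exact zero_mem (harmSpan l)
  | succ k ih =>
    -- The degree for which `rodrigues d m.natAbs` has degree exactly `k`.
    set d := m.natAbs + k
    have hd : d - m.natAbs = k := by omega
    have hmd : m.natAbs ≤ d := by omega
    have hc : (rodrigues d m.natAbs).coeff k ≠ 0 := by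
      have := coeff_rodrigues hmd
      rw [hd] at this
      rw [this]
      positivity
    set a := p.coeff k / (rodrigues d m.natAbs).coeff k with ha
    have h1 := ih (by omega) (p - Polynomial.C a * rodrigues d m.natAbs) (fun j hj => by
      rcases hj.eq_or_lt with rfl | hj
      · simp [ha, hc]
      · have h2 := natDegree_rodrigues_le d m.natAbs
        rw [Polynomial.coeff_sub, Polynomial.coeff_C_mul, hp j hj,
          Polynomial.coeff_eq_zero_of_natDegree_lt (by omega)]
        simp)
    have h2 : Y (idx d m) ∈ harmSpan l :=
      subset_span ⟨_, by rw [Set.mem_ofPred_eq, deg_idx hmd]; omega, rfl⟩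
    have h3 := add_mem h1 (smul_mem _ ((a / harmConst d m : ℝ) : ℂ) h2)
    convert h3 using 1
    ext x
    have h4 : (harmConst d m : ℂ) ≠ 0 := by exact_mod_cast harmConst_ne_zero hmd
    rw [Y_idx hmd]
    simp only [Pi.add_apply, Pi.smul_apply, smul_eq_mul, sphHarm_eq hmd, Polynomial.eval_sub,
      Polynomial.eval_mul, Polynomial.eval_C]
    push_cast
    field_simp
    ring

lemma cylSpan_le_harmSpan (l : ℕ) : cylSpan l ≤ harmSpan l := by
  rw [cylSpan, span_le]
  rintro _ ⟨m, k, h, rfl⟩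
  rw [SetLike.mem_coe]
  convert planarPow_mul_zonal_mem (m := m) (k := k + 1) (l := l) (by omega) (Polynomial.X ^ k)
    (fun j hj => by rw [Polynomial.coeff_X_pow, if_neg (by omega)]) using 1
  ext x
  simp [coordFun]

/-- The spherical harmonics of degree at most `l` span the polynomial functions of degree at
most `l`. -/
theorem affineSpan_pow_eq (l : ℕ) : affineSpan ^ l = harmSpan l :=
  le_antisymm ((affineSpan_pow_le_cylSpan l).trans (cylSpan_le_harmSpan l)) (harmSpan_le l)

lemma mul_mem_harmSpan {l l' : ℕ} {f g : S2 → ℂ} (hf : f ∈ harmSpan l) (hg : g ∈ harmSpan l') :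
    f * g ∈ harmSpan (l + l') := by
  rw [← affineSpan_pow_eq] at *
  rw [pow_add]
  exact mul_mem_mul hf hg

lemma harmSpan_mono {l l' : ℕ} (h : l ≤ l') : harmSpan l ≤ harmSpan l' := by
  rw [← affineSpan_pow_eq, ← affineSpan_pow_eq]
  exact affineSpan_pow_mono h

lemma Y_mem_harmSpan (n : ℕ) : Y n ∈ harmSpan (deg n) := subset_span ⟨n, le_refl (deg n), rfl⟩

lemma conj_mem_harmSpan {l : ℕ} {g : S2 → ℂ} (hg : g ∈ harmSpan l) :
    (fun x => conj (g x)) ∈ harmSpan l :=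
  cylSpan_le_harmSpan l (conj_mem_cylSpan
    (affineSpan_pow_le_cylSpan l ((affineSpan_pow_eq l).ge hg)))

/-- Composition with an isometry, as an algebra homomorphism. -/
def compAlgHom (A : E3 ≃ₗᵢ[ℝ] E3) : (S2 → ℂ) →ₐ[ℂ] (S2 → ℂ) where
  toFun g := g ∘ sphereMap A
  map_one' := rfl
  map_mul' _ _ := rfl
  map_zero' := rfl
  map_add' _ _ := rfl
  commutes' _ := rfl

lemma map_affineSpan_le (A : E3 ≃ₗᵢ[ℝ] E3) :
    affineSpan.map (compAlgHom A).toLinearMap ≤ affineSpan := by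
  nth_rw 1 [affineSpan]
  rw [map_span, span_le]
  rintro _ ⟨f, rfl | ⟨i, rfl⟩, rfl⟩
  · simpa using one_mem_affineSpan
  · have : (compAlgHom A).toLinearMap (coordFun i) =
        ∑ j, ((A (EuclideanSpace.single j 1) i : ℝ) : ℂ) • coordFun j := by
      ext x
      have hx : x.1 = ∑ j, x.1 j • EuclideanSpace.single j (1 : ℝ) := by
        ext k
        fin_cases k <;> simp [Fin.sum_univ_three]
      change ((A x.1 i : ℝ) : ℂ) = _
      nth_rw 1 [hx]
      simp [coordFun, mul_comm]
    rw [SetLike.mem_coe, this]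
    exact sum_mem fun j _ => smul_mem _ _ (coordFun_mem_affineSpan j)

/-- An isometry acts linearly on the coordinates, so it preserves affine functions and hence
polynomials of degree at most `l`. -/
lemma comp_mem_harmSpan (A : E3 ≃ₗᵢ[ℝ] E3) {l : ℕ} {g : S2 → ℂ} (hg : g ∈ harmSpan l) :
    (fun x => g (sphereMap A x)) ∈ harmSpan l := by
  rw [← affineSpan_pow_eq] at *
  have h1 : (affineSpan ^ l).map (compAlgHom A).toLinearMap ≤ affineSpan ^ l := by
    rw [Submodule.map_pow]
    exact pow_le_pow_left' (map_affineSpan_le A) l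
  exact h1 (mem_map_of_mem hg)

end Polynomials

/-! ### Harmonic coefficients -/

section Coefficients

lemma memLp_of_continuous {g : S2 → ℂ} (hg : Continuous g) (p : ℝ≥0∞) : MemLp g p area := by
  obtain ⟨C, hC⟩ := isCompact_univ.exists_bound_of_continuousOn hg.continuousOn
  exact MemLp.of_bound hg.aestronglyMeasurable C (.of_forall fun x => hC x trivial)

lemma integrable_mul_continuous {f g : S2 → ℂ} (hf : MemLp f 2 area) (hg : Continuous g) :
    Integrable (fun x => f x * g x) area :=
  hf.integrable_mul (memLp_of_continuous hg 2)

lemma continuous_conj_Y (n : ℕ) : Continuous fun x => conj (Y n x) :=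
  Complex.continuous_conj.comp (continuous_Y n)

lemma integrable_mul_conj_Y {f : S2 → ℂ} (hf : MemLp f 2 area) (n : ℕ) :
    Integrable (fun x => f x * conj (Y n x)) area :=
  integrable_mul_continuous hf (continuous_conj_Y n)

lemma coeff_add {f g : S2 → ℂ} (hf : MemLp f 2 area) (hg : MemLp g 2 area) (n : ℕ) :
    coeff (fun x => f x + g x) n = coeff f n + coeff g n := by
  simp only [coeff, add_mul]
  exact integral_add (integrable_mul_conj_Y hf n) (integrable_mul_conj_Y hg n)

lemma coeff_sub {f g : S2 → ℂ} (hf : MemLp f 2 area) (hg : MemLp g 2 area) (n : ℕ) :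
    coeff (fun x => f x - g x) n = coeff f n - coeff g n := by
  simp only [coeff, sub_mul]
  exact integral_sub (integrable_mul_conj_Y hf n) (integrable_mul_conj_Y hg n)

lemma continuous_sum_Y (s : Finset ℕ) (c : ℕ → ℂ) :
    Continuous fun x => ∑ n ∈ s, c n * Y n x :=
  continuous_finsetSum _ fun n _ => continuous_const.mul (continuous_Y n)

lemma coeff_sum (s : Finset ℕ) (c : ℕ → ℂ) (k : ℕ) :
    coeff (fun x => ∑ n ∈ s, c n * Y n x) k = if k ∈ s then c k else 0 := by
  simp only [coeff, Finset.sum_mul, mul_assoc]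
  have h (n : ℕ) : Integrable (fun x => c n * (Y n x * conj (Y k x))) area :=
    (integrable_of_continuous ((continuous_Y n).mul (continuous_conj_Y k))).const_mul _
  rw [integral_finsetSum _ fun n _ => h n]
  simp [integral_const_mul, integral_Y_mul_conj]

lemma eq_sum_of_mem_harmSpan {l : ℕ} {g : S2 → ℂ} (hg : g ∈ harmSpan l) :
    g = fun x => ∑ n ∈ Finset.range ((l + 1) ^ 2), coeff g n * Y n x := by
  have h1 : {n | deg n ≤ l} = (Finset.range ((l + 1) ^ 2) : Set ℕ) := by
    ext n
    simp [deg_le_iff]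
  rw [harmSpan, h1, Submodule.mem_span_image_finset_iff_exists_fun'] at hg
  obtain ⟨c, hc⟩ := hg
  have h2 : g = fun x => ∑ n ∈ Finset.range ((l + 1) ^ 2), c n * Y n x := by
    rw [← hc]
    ext x
    simp
  have h3 : ∀ n ∈ Finset.range ((l + 1) ^ 2), coeff g n = c n := fun n hn => by
    rw [h2, coeff_sum, if_pos hn]
  conv_lhs => rw [h2]
  ext x
  exact Finset.sum_congr rfl fun n hn => by rw [h3 n hn]

lemma coeff_eq_zero_of_mem_harmSpan {l n : ℕ} {g : S2 → ℂ} (hg : g ∈ harmSpan l)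
    (hn : (l + 1) ^ 2 ≤ n) : coeff g n = 0 := by
  rw [eq_sum_of_mem_harmSpan hg, coeff_sum, if_neg (by simpa using hn)]

end Coefficients

/-! ### Completeness and Bessel's inequality -/

section Completeness

open Submodule

/-- The spherical harmonics as continuous maps. -/
def YC (n : ℕ) : C(S2, ℂ) := ⟨Y n, continuous_Y n⟩

/-- The spherical harmonics as elements of `L²`. -/
def YL (n : ℕ) : Lp ℂ 2 area := ContinuousMap.toLp 2 area ℂ (YC n)

/-- The star subalgebra of polynomial functions on the sphere. -/
def polyAlgebra : StarSubalgebra ℂ C(S2, ℂ) where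
  carrier := {g | ∃ l, (g : S2 → ℂ) ∈ harmSpan l}
  mul_mem' := fun ⟨l, hl⟩ ⟨l', hl'⟩ => ⟨l + l', mul_mem_harmSpan hl hl'⟩
  add_mem' := fun ⟨l, hl⟩ ⟨l', hl'⟩ =>
    ⟨max l l', add_mem (harmSpan_mono (le_max_left _ _) hl) (harmSpan_mono (le_max_right _ _) hl')⟩
  algebraMap_mem' := fun a => ⟨0, by
    rw [← affineSpan_pow_eq, pow_zero, one_eq_span]
    exact mem_span_singleton.2 ⟨a, by ext x; simp⟩⟩
  star_mem' := fun ⟨l, hl⟩ => ⟨l, conj_mem_harmSpan hl⟩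

lemma polyAlgebra_separatesPoints : polyAlgebra.SeparatesPoints := by
  intro x y hxy
  have : ∃ i, x.1 i ≠ y.1 i := by
    by_contra! h
    exact hxy (Subtype.ext (by ext i; exact h i))
  obtain ⟨i, hi⟩ := this
  refine ⟨coordFun i, ⟨⟨coordFun i, Complex.continuous_ofReal.comp (continuous_coord i)⟩,
    ⟨1, ?_⟩, rfl⟩, ?_⟩
  · rw [← affineSpan_pow_eq, pow_one]
    exact coordFun_mem_affineSpan i
  · simpa [coordFun] using hi

/-- Stone–Weierstrass: finite combinations of harmonics form a star subalgebra, which contains the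
coordinates and so separates points. -/
lemma span_YC_closure_eq_top : (span ℂ (Set.range YC)).topologicalClosure = ⊤ := by
  have h1 := ContinuousMap.starSubalgebra_topologicalClosure_eq_top_of_separatesPoints
    polyAlgebra polyAlgebra_separatesPoints
  have h2 : Subalgebra.toSubmodule polyAlgebra.toSubalgebra ≤ span ℂ (Set.range YC) := by
    rintro g ⟨l, hl⟩
    have h3 : g = ∑ n ∈ Finset.range ((l + 1) ^ 2), coeff g n • YC n := by
      ext x
      have := congrFun (eq_sum_of_mem_harmSpan hl) x
      simpa [YC] using this
    rw [h3]
    exact sum_mem fun n _ => smul_mem _ _ (subset_span ⟨n, rfl⟩)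
  rw [eq_top_iff]
  intro g _
  have h4 : g ∈ polyAlgebra.topologicalClosure := h1 ▸ trivial
  exact closure_mono (s := (polyAlgebra : Set C(S2, ℂ))) h2 h4

lemma span_YL_closure_eq_top : (span ℂ (Set.range YL)).topologicalClosure = ⊤ := by
  convert! (ContinuousMap.toLp_denseRange ℂ area ℂ
    (by simp : (2 : ℝ≥0∞) ≠ ∞)).topologicalClosure_map_submodule span_YC_closure_eq_top
  rw [map_span]
  unfold YL
  rw [Set.range_comp']
  simp only [ContinuousLinearMap.coe_coe]

lemma inner_YL {f : S2 → ℂ} (hf : MemLp f 2 area) (n : ℕ) :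
    inner ℂ (YL n) (hf.toLp f) = coeff f n := by
  rw [L2.inner_def, coeff]
  refine integral_congr_ae ?_
  filter_upwards [hf.coeFn_toLp, ContinuousMap.coeFn_toLp (p := 2) area (𝕜 := ℂ) (YC n)]
    with x h1 h2
  rw [h1, YL, h2]
  simp [YC]

lemma YL_eq (n : ℕ) : YL n = (memLp_of_continuous (continuous_Y n) 2).toLp (Y n) := by
  refine Lp.ext ?_
  filter_upwards [(memLp_of_continuous (continuous_Y n) 2).coeFn_toLp,
    ContinuousMap.coeFn_toLp (p := 2) area (𝕜 := ℂ) (YC n)] with x h1 h2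
  rw [h1, YL, h2]
  rfl

lemma orthonormal_YL : Orthonormal ℂ YL := by
  rw [orthonormal_iff_ite]
  intro i j
  rw [YL_eq j, inner_YL, coeff, integral_Y_mul_conj]
  simp [eq_comm]

/-- Square-integrable functions whose harmonic coefficients all vanish are zero. -/
lemma ae_eq_zero_of_coeff {f : S2 → ℂ} (hf : MemLp f 2 area) (h : ∀ n, coeff f n = 0) :
    f =ᵐ[area] 0 := by
  let b := HilbertBasis.mk orthonormal_YL span_YL_closure_eq_top.ge
  have h1 : b.repr (hf.toLp f) = 0 := by
    ext n
    rw [b.repr_apply_apply, HilbertBasis.coe_mk, inner_YL, h n]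
    rfl
  have h2 : hf.toLp f = 0 := by simpa using h1
  rw [Lp.eq_zero_iff_ae_eq_zero] at h2
  exact hf.coeFn_toLp.symm.trans h2

lemma enorm_toLp_sq {f : S2 → ℂ} (hf : MemLp f 2 area) :
    ‖hf.toLp f‖ₑ ^ 2 = ∫⁻ x, ‖f x‖ₑ ^ 2 ∂area := by
  rw [Lp.enorm_toLp, eLpNorm_eq_lintegral_rpow_enorm_toReal (by simp) (by simp)]
  rw [← ENNReal.rpow_natCast, ← ENNReal.rpow_mul]
  simp

/-- Bessel's inequality. -/
lemma tsum_enorm_coeff_sq_le {f : S2 → ℂ} (hf : MemLp f 2 area) :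
    ∑' n, ‖coeff f n‖ₑ ^ 2 ≤ ∫⁻ x, ‖f x‖ₑ ^ 2 ∂area := by
  rw [← enorm_toLp_sq hf]
  refine ENNReal.tsum_le_of_sum_range_le fun N => ?_
  have h1 := orthonormal_YL.sum_inner_products_le (s := Finset.range N) (hf.toLp f)
  simp only [inner_YL] at h1
  have h2 : ∀ {E : Type} [NormedAddCommGroup E] (v : E), ‖v‖ₑ ^ 2 = ENNReal.ofReal (‖v‖ ^ 2) := by
    intro E _ v
    rw [← ofReal_norm, ENNReal.ofReal_pow (norm_nonneg _)]
  simp only [h2]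
  rw [← ENNReal.ofReal_sum_of_nonneg fun _ _ => by positivity]
  exact ENNReal.ofReal_le_ofReal h1

/-- Parseval's identity for finite sums of spherical harmonics. -/
lemma lintegral_enorm_sum_Y (s : Finset ℕ) (c : ℕ → ℂ) :
    ∫⁻ x, ‖∑ n ∈ s, c n * Y n x‖ₑ ^ 2 ∂area = ∑ n ∈ s, ‖c n‖ₑ ^ 2 := by
  have hm := memLp_of_continuous (continuous_sum_Y s c) 2
  have h1 : hm.toLp _ = ∑ n ∈ s, c n • YL n := by
    refine Lp.ext ?_
    have h3 : ∑ n ∈ s, c n • YL n = ContinuousMap.toLp 2 area ℂ (∑ n ∈ s, c n • YC n) := by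
      simp [YL]
    rw [h3]
    filter_upwards [hm.coeFn_toLp,
      ContinuousMap.coeFn_toLp (p := 2) area (𝕜 := ℂ) (∑ n ∈ s, c n • YC n)] with x h4 h5
    rw [h4, h5]
    simp [YC]
  have h2 : ‖hm.toLp _‖ ^ 2 = ∑ n ∈ s, ‖c n‖ ^ 2 := by
    have h4 := orthonormal_YL.inner_sum c c s
    rw [← h1, inner_self_eq_norm_sq_to_K] at h4
    have h5 : ∀ i, conj (c i) * c i = ((‖c i‖ ^ 2 : ℝ) : ℂ) := fun i => by
      rw [Complex.conj_mul']
      norm_cast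
    simp only [h5] at h4
    rw [← Complex.ofReal_sum] at h4
    have h6 := congrArg Complex.re h4
    rw [Complex.ofReal_re] at h6
    rw [← h6]
    norm_cast
  rw [← enorm_toLp_sq hm, ← ofReal_norm, ← ENNReal.ofReal_pow (norm_nonneg _), h2,
    ENNReal.ofReal_sum_of_nonneg fun _ _ => by positivity]
  refine Finset.sum_congr rfl fun n _ => ?_
  rw [← ofReal_norm, ENNReal.ofReal_pow (norm_nonneg _)]

end Completeness

/-! ### The addition theorem -/

section Addition

/-- The reproducing kernel of the polynomial functions of degree less than `l`. -/
def kernelBelow (l : ℕ) (x y : S2) : ℂ := ∑ n ∈ Finset.range (l ^ 2), Y n x * conj (Y n y)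

/-- An isometry preserves both the space of polynomials and the inner product, so it acts on the
orthonormal basis by a unitary matrix `U`, which drops out of the kernel. -/
lemma kernelBelow_sphereMap (A : E3 ≃ₗᵢ[ℝ] E3) (l : ℕ) (x y : S2) :
    kernelBelow l (sphereMap A x) (sphereMap A y) = kernelBelow l x y := by
  rcases l with _ | l
  · simp [kernelBelow]
  set N := (l + 1) ^ 2
  let U : Matrix (Fin N) (Fin N) ℂ := fun n k => coeff (fun x => Y n (sphereMap A x)) k
  have hU : ∀ (n : Fin N) (x : S2), Y n (sphereMap A x) = ∑ k : Fin N, U n k * Y k x := by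
    intro n x
    have hn : Y n ∈ harmSpan l :=
      Submodule.subset_span ⟨n, (deg_le_iff n l).2 n.2, rfl⟩
    have h1 := congrFun (eq_sum_of_mem_harmSpan (comp_mem_harmSpan A hn)) x
    rw [← Fin.sum_univ_eq_sum_range
      (fun k => coeff (fun x => Y n (sphereMap A x)) k * Y k x)] at h1
    exact h1
  have hUU : U * U.conjTranspose = 1 := by
    ext n n'
    have h1 := integral_comp_sphereMap A (fun x => Y n x * conj (Y n' x))
    rw [integral_Y_mul_conj] at h1
    rw [Matrix.one_apply, Matrix.mul_apply]
    simp only [← Fin.ext_iff] at h1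
    rw [← h1]
    simp only [hU n', map_sum, map_mul, Finset.mul_sum, Matrix.conjTranspose_apply]
    have hc : Continuous fun x => Y n (sphereMap A x) :=
      (continuous_Y n).comp (continuous_sphereMap A)
    have hi (k : Fin N) : Integrable
        (fun x => Y n (sphereMap A x) * (conj (U n' k) * conj (Y k x))) area :=
      integrable_of_continuous (hc.mul (continuous_const.mul (continuous_conj_Y k)))
    rw [integral_finsetSum _ fun k _ => hi k]
    refine Finset.sum_congr rfl fun k _ => ?_
    simp only [mul_left_comm _ (conj (U n' k)), integral_const_mul]
    rw [mul_comm]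
    rfl
  -- Orthonormality gives `U U* = 1`; the kernel needs `U* U = 1`, which follows for square
  -- matrices.
  have hUU' : U.conjTranspose * U = 1 := mul_eq_one_comm.1 hUU
  have hk : ∀ x y, kernelBelow (l + 1) x y = ∑ n : Fin N, Y n x * conj (Y n y) := fun x y => by
    rw [kernelBelow, Fin.sum_univ_eq_sum_range (fun n => Y n x * conj (Y n y))]
  rw [hk, hk]
  have h2 : ∀ k' k, ∑ n, conj (U n k') * U n k = if k' = k then 1 else 0 := fun k' k => by
    have := congrFun (congrFun hUU' k') k
    rw [Matrix.one_apply, Matrix.mul_apply] at this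
    exact this
  calc ∑ n : Fin N, Y n (sphereMap A x) * conj (Y n (sphereMap A y))
      = ∑ n, ∑ k, ∑ k', (conj (U n k') * U n k) * (Y k x * conj (Y k' y)) := by
        refine Finset.sum_congr rfl fun n _ => ?_
        rw [hU, hU, map_sum, Finset.sum_mul_sum]
        refine Finset.sum_congr rfl fun k _ => Finset.sum_congr rfl fun k' _ => ?_
        rw [map_mul]
        ring
    _ = ∑ k : Fin N, ∑ k' : Fin N, (∑ n, conj (U n k') * U n k) * (Y k x * conj (Y k' y)) := by
        rw [Finset.sum_comm]
        refine Finset.sum_congr rfl fun k _ => ?_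
        rw [Finset.sum_comm]
        refine Finset.sum_congr rfl fun k' _ => ?_
        rw [Finset.sum_mul]
    _ = ∑ k : Fin N, Y k x * conj (Y k y) := by
        simp [h2]

/-- The reproducing kernel of the spherical harmonics of degree `p`. -/
def kernelDeg (p : ℕ) (x y : S2) : ℂ :=
  ∑ n ∈ Finset.Ico (p ^ 2) ((p + 1) ^ 2), Y n x * conj (Y n y)

/-- Subtracting the kernels of two consecutive filtration steps avoids showing that each single
degree is invariant. -/
lemma kernelDeg_sphereMap (A : E3 ≃ₗᵢ[ℝ] E3) (p : ℕ) (x y : S2) :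
    kernelDeg p (sphereMap A x) (sphereMap A y) = kernelDeg p x y := by
  have h : ∀ x y, kernelDeg p x y = kernelBelow (p + 1) x y - kernelBelow p x y := fun x y =>
    Finset.sum_Ico_eq_sub _ (Nat.pow_le_pow_left (Nat.le_succ p) 2)
  rw [h, h, kernelBelow_sphereMap, kernelBelow_sphereMap]

/-- The north pole. -/
def northPole : S2 := ⟨!₂[0, 0, 1], mem_sphere_of_sq (by norm_num)⟩

/-- Leibniz rule on `(X - 1)^p (X + 1)^p`: at `1` only the term with all derivatives on the first
factor survives. -/
lemma eval_one_rodrigues_zero (p : ℕ) :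
    (rodrigues p 0).eval 1 = 2 ^ p * p.factorial := by
  open Polynomial in
  have h1 : (X ^ 2 - 1 : ℝ[X]) ^ p = (X - C 1) ^ p * (X + 1) ^ p := by
    rw [← mul_pow]
    congr 1
    simp only [map_one]
    ring
  rw [rodrigues, add_zero, h1, Polynomial.iterate_derivative_mul, Polynomial.eval_finsetSum,
    Finset.sum_eq_single_of_mem _ (Finset.mem_range.mpr p.succ_pos)]
  · rw [p.choose_zero_right, one_smul, Polynomial.eval_mul, p.sub_zero,
      Polynomial.iterate_derivative_X_sub_pow_self, Polynomial.eval_natCast]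
    simp only [Function.iterate_zero, id, Polynomial.eval_pow, Polynomial.eval_add,
      Polynomial.eval_X, Polynomial.eval_one]
    norm_num [mul_comm]
  · intro b hb hb0
    rw [Polynomial.iterate_derivative_X_sub_pow, Polynomial.eval_smul, Polynomial.eval_mul,
      Polynomial.eval_smul, Polynomial.eval_pow, Nat.sub_sub_self (Finset.mem_range_succ_iff.mp hb),
      Polynomial.eval_sub, Polynomial.eval_X, Polynomial.eval_C, sub_self,
      zero_pow hb0, smul_zero, zero_mul, smul_zero]

lemma Y_northPole_of_ord_ne_zero {n : ℕ} (h : ord n ≠ 0) : Y n northPole = 0 := by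
  have h1 : planar northPole = 0 := by apply Complex.ext <;> simp [planar, northPole]
  rw [Y_eq, planarPow, h1]
  simp [h]

lemma Y_northPole (p : ℕ) : Y (idx p 0) northPole = (√((2 * p + 1) / (4 * Real.pi)) : ℝ) := by
  have h0 : (0 : ℤ).natAbs ≤ p := by simp
  have h1 : northPole.1 2 = 1 := by simp [northPole]
  rw [Y_idx h0, sphHarm_eq h0, h1, Int.natAbs_zero, eval_one_rodrigues_zero]
  simp only [planarPow, harmConst, normFactor]
  have h2 : (p.factorial : ℂ) ≠ 0 := by exact_mod_cast p.factorial_ne_zero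
  have h3 : ((p.factorial : ℝ) / p.factorial) = 1 := div_self (by positivity)
  simp [h3]
  field_simp

/-- The isometry taking a point of the sphere to the north pole. -/
def poleIso (y : S2) : E3 ≃ₗᵢ[ℝ] E3 := (rotZIso (-longitude y)).trans (rotYIso (-colatitude y))

lemma sphereMap_poleIso (y x : S2) :
    sphereMap (poleIso y) x = rotY (-colatitude y) (rotZ (-longitude y) x) := rfl

lemma sphereMap_poleIso_self (y : S2) : sphereMap (poleIso y) y = northPole := by
  have h0 : √(1 - y.1 2 ^ 2) * Real.cos (longitude y) = y.1 0 := by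
    rw [← norm_planar]
    exact Complex.norm_mul_cos_arg _
  have h1 : √(1 - y.1 2 ^ 2) * Real.sin (longitude y) = y.1 1 := by
    rw [← norm_planar]
    exact Complex.norm_mul_sin_arg _
  have h2 : Real.sin (colatitude y) = √(1 - y.1 2 ^ 2) := Real.sin_arccos _
  have h3 := cos_colatitude y
  have h4 := Real.sin_sq_add_cos_sq (longitude y)
  have h5 := Real.sin_sq_add_cos_sq (colatitude y)
  rw [← h2] at h0 h1
  rw [sphereMap_poleIso]
  apply Subtype.ext
  ext i
  fin_cases i
  · simp [rotY, rotZ, northPole]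
    rw [← h0, ← h1, ← h3]
    linear_combination Real.cos (colatitude y) * Real.sin (colatitude y) * h4
  · simp [rotY, rotZ, northPole]
    rw [← h0, ← h1]
    ring
  · simp [rotY, rotZ, northPole]
    rw [← h0, ← h1, ← h3]
    linear_combination Real.sin (colatitude y) ^ 2 * h4 + h5

/-- The addition theorem: a rotated zonal harmonic expands into the harmonics of its degree. -/
theorem zonal_rotate (p : ℕ) (x y : S2) :
    Y (idx p 0) (sphereMap (poleIso y) x) = (√(4 * Real.pi / (2 * p + 1)) : ℝ) *
      ∑ n ∈ Finset.Ico (p ^ 2) ((p + 1) ^ 2), Y n x * conj (Y n y) := by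
  have h0 : (0 : ℤ).natAbs ≤ p := by simp
  have h1 := kernelDeg_sphereMap (poleIso y) p x y
  rw [sphereMap_poleIso_self] at h1
  -- Harmonics of non-zero order vanish at the pole, so the invariant kernel reduces there to the
  -- zonal term.
  have h2 : kernelDeg p (sphereMap (poleIso y) x) northPole =
      Y (idx p 0) (sphereMap (poleIso y) x) * (√((2 * p + 1) / (4 * Real.pi)) : ℝ) := by
    rw [kernelDeg, Finset.sum_eq_single (idx p 0), Y_northPole, Complex.conj_ofReal]
    · intro n hn hne
      rw [Finset.mem_Ico] at hn
      have h3 : deg n = p := by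
        refine le_antisymm ((deg_le_iff n p).2 hn.2) ?_
        exact Nat.le_sqrt'.2 hn.1
      rw [Y_northPole_of_ord_ne_zero, map_zero, mul_zero]
      intro h4
      apply hne
      rw [← idx_deg_ord n, h3, h4]
    · intro hn
      exfalso
      apply hn
      rw [Finset.mem_Ico]
      have h3 := deg_idx h0
      refine ⟨Nat.le_sqrt'.1 h3.ge, (deg_le_iff _ _).1 h3.le⟩
  rw [h2, kernelDeg] at h1
  rw [← h1]
  have h5 : (√(4 * Real.pi / (2 * p + 1)) : ℝ) * √((2 * p + 1) / (4 * Real.pi)) = 1 := by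
    rw [← Real.sqrt_mul (by positivity), Real.sqrt_eq_one]
    have := Real.pi_ne_zero
    field_simp
  have h6 : ((√(4 * Real.pi / (2 * p + 1)) : ℝ) : ℂ) * (√((2 * p + 1) / (4 * Real.pi)) : ℝ) = 1 := by
    exact_mod_cast h5
  linear_combination -Y (idx p 0) (sphereMap (poleIso y) x) * h6

end Addition

/-! ### The harmonic expansion of the SLSHT distribution -/

section Window

/-- Rotation about the `z`-axis by `π / ord n` fixes `h` and changes the sign of `Y n`. -/
lemma coeff_eq_zero_of_symmetric {h : S2 → ℂ}
    (hs : ∀ x x' : S2, colatitude x = colatitude x' → h x = h x') {n : ℕ} (hn : ord n ≠ 0) :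
    coeff h n = 0 := by
  have h1 := integral_comp_sphereMap (rotZIso (Real.pi / ord n))
    (fun x => h x * conj (Y n x))
  rw [sphereMap_rotZIso] at h1
  have h2 : ∀ x : S2, h (rotZ (Real.pi / ord n) x) * conj (Y n (rotZ (Real.pi / ord n) x)) =
      -(h x * conj (Y n x)) := by
    intro x
    have hne : (ord n : ℂ) ≠ 0 := by exact_mod_cast hn
    have h3 : Complex.exp (Complex.I * ord n * ((Real.pi / ord n : ℝ) : ℂ)) = -1 := by
      rw [← Complex.exp_pi_mul_I]
      congr 1
      push_cast
      field_simp
    have h5 : (rotZ (Real.pi / ord n) x).1 2 = x.1 2 := rfl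
    have h6 : h (rotZ (Real.pi / ord n) x) = h x := hs _ _ (by rw [colatitude, h5, colatitude])
    rw [h6, Y_eq, Y_eq, planarPow_rotZ, h3, h5]
    simp
  simp only [h2, integral_neg] at h1
  exact self_eq_neg.1 h1.symm

/-- Both sides have the same coefficients, since symmetry kills the non-zero orders and
band-limitation the high degrees; completeness does the rest. -/
lemma window_ae_eq {L : ℕ} {h : S2 → ℂ} (hh : IsWindow L h) :
    h =ᵐ[area] fun x => ∑ p ∈ Finset.range (L + 1), coeff h (idx p 0) * Y (idx p 0) x := by
  have h0 (p : ℕ) : (0 : ℤ).natAbs ≤ p := by simp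
  set s := (Finset.range (L + 1)).image fun p => idx p 0 with hs
  have h1 : ∀ x, ∑ p ∈ Finset.range (L + 1), coeff h (idx p 0) * Y (idx p 0) x =
      ∑ n ∈ s, coeff h n * Y n x := by
    intro x
    rw [hs, Finset.sum_image]
    intro p _ q _ hpq
    rw [← deg_idx (h0 p), ← deg_idx (h0 q)]
    exact congrArg deg hpq
  simp only [h1]
  have hm := memLp_of_continuous (continuous_sum_Y s (coeff h)) 2
  have h2 := ae_eq_zero_of_coeff (hh.bandLimited.1.sub hm) (fun n => by
    refine (coeff_sub hh.bandLimited.1 hm n).trans ?_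
    rw [coeff_sum]
    split_ifs with hn
    · simp
    · rw [sub_zero]
      by_cases hd : L < deg n
      · exact hh.bandLimited.2 n hd
      · refine coeff_eq_zero_of_symmetric hh.symmetric fun ho => hn ?_
        rw [hs, Finset.mem_image]
        exact ⟨deg n, by rw [Finset.mem_range]; omega, by rw [← ho, idx_deg_ord]⟩)
  filter_upwards [h2] with x hx
  simpa [sub_eq_zero] using hx

lemma sum_range_sq (F : ℕ → ℂ) (L : ℕ) :
    ∑ p ∈ Finset.range L, ∑ n ∈ Finset.Ico (p ^ 2) ((p + 1) ^ 2), F n =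
      ∑ n ∈ Finset.range (L ^ 2), F n := by
  induction L with
  | zero => simp
  | succ L ih =>
    rw [Finset.sum_range_succ, ih, Finset.sum_range_add_sum_Ico]
    exact Nat.pow_le_pow_left (Nat.le_succ L) 2

lemma deg_of_mem_Ico {n p : ℕ} (hn : n ∈ Finset.Ico (p ^ 2) ((p + 1) ^ 2)) : deg n = p := by
  rw [Finset.mem_Ico] at hn
  exact le_antisymm ((deg_le_iff n p).2 hn.2) (Nat.le_sqrt'.2 hn.1)

lemma rotate_ae_eq {L : ℕ} {h : S2 → ℂ} (hh : IsWindow L h) (y : S2) :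
    rotate y h =ᵐ[area] fun x => ∑ r ∈ Finset.range ((L + 1) ^ 2),
      (√(4 * Real.pi / (2 * deg r + 1)) : ℝ) * coeff h (idx (deg r) 0) * conj (Y r y) * Y r x := by
  have h1 := (measurePreserving_sphereMap (poleIso y)).quasiMeasurePreserving.ae_eq_comp
    (window_ae_eq hh)
  filter_upwards [h1] with x hx
  rw [rotate, ← sphereMap_poleIso]
  refine hx.trans ?_
  simp only [Function.comp_apply]
  rw [← sum_range_sq]
  refine Finset.sum_congr rfl fun p _ => ?_
  rw [zonal_rotate, Finset.mul_sum, Finset.mul_sum]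
  refine Finset.sum_congr rfl fun r hr => ?_
  rw [deg_of_mem_Ico hr]
  ring

/-- The factor of `H(c; r; n)` that depends on the window. -/
def windowFactor (h : S2 → ℂ) (r : ℕ) : ℂ :=
  (-1) ^ (ord r).natAbs * (√(4 * Real.pi / (2 * deg r + 1)) : ℂ) * coeff h (idx (deg r) 0)

lemma H_eq (h : S2 → ℂ) (c r n : ℕ) : H h c r n = windowFactor h r * T c (negIdx r) n := rfl

lemma natAbs_neg_ord_le (r : ℕ) : (-ord r).natAbs ≤ deg r := by simpa using natAbs_ord_le r

lemma deg_negIdx (r : ℕ) : deg (negIdx r) = deg r := deg_idx (natAbs_neg_ord_le r)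

lemma ord_negIdx (r : ℕ) : ord (negIdx r) = -ord r := ord_idx (natAbs_neg_ord_le r)

lemma negIdx_negIdx (r : ℕ) : negIdx (negIdx r) = r := by
  rw [negIdx, deg_negIdx, ord_negIdx, neg_neg, idx_deg_ord]

lemma memLp_Y_mul {f : S2 → ℂ} (hf : MemLp f 2 area) (k : ℕ) :
    MemLp (fun x => Y k x * f x) 2 area :=
  hf.mul (memLp_of_continuous (continuous_Y k) ∞)

/-- Every component of the SLSHT distribution is band-limited. -/
theorem slsht_eq {L : ℕ} {h f : S2 → ℂ} (hh : IsWindow L h) (hf : MemLp f 2 area) (n : ℕ)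
    (y : S2) : slsht h f n y = ∑ r ∈ Finset.range ((L + 1) ^ 2),
      windowFactor h r * coeff (fun x => Y (negIdx r) x * f x) n * Y r y := by
  have h1 : slsht h f n y = ∫ x, ∑ r ∈ Finset.range ((L + 1) ^ 2),
      ((√(4 * Real.pi / (2 * deg r + 1)) : ℝ) * coeff h (idx (deg r) 0) * conj (Y r y)) *
        (Y r x * f x * conj (Y n x)) ∂area := by
    refine integral_congr_ae ?_
    filter_upwards [rotate_ae_eq hh y] with x hx
    rw [hx, Finset.sum_mul, Finset.sum_mul]
    refine Finset.sum_congr rfl fun r _ => ?_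
    ring
  rw [h1, integral_finsetSum _ fun r _ =>
    (integrable_mul_conj_Y (memLp_Y_mul hf r) n).const_mul _]
  simp only [integral_const_mul]
  have hmem : ∀ r ∈ Finset.range ((L + 1) ^ 2), negIdx r ∈ Finset.range ((L + 1) ^ 2) := by
    intro r hr
    rw [Finset.mem_range, ← deg_le_iff] at *
    rwa [deg_negIdx]
  -- Reversing the order turns `conj (Y r y)` into a signed harmonic in `y`; this is the origin of
  -- the sign and of the `-q` in `H`.
  refine Finset.sum_nbij' negIdx negIdx hmem hmem (fun r _ => negIdx_negIdx r)
    (fun r _ => negIdx_negIdx r) fun r _ => ?_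
  change _ * coeff (fun x => Y r x * f x) n = _
  rw [conj_Y, windowFactor, deg_negIdx, ord_negIdx, negIdx_negIdx, Int.natAbs_neg]
  ring

end Window

/-! ### Triple products: reality and finite support. -/

section TripleProduct

lemma planarPow_refl (m : ℤ) (x : S2) :
    planarPow m (sphereMap reflIso x) = conj (planarPow m x) := by
  have h : planar (sphereMap reflIso x) = conj (planar x) := by
    apply Complex.ext <;> simp [planar, sphereMap, reflIso, isoOfNorm]
  unfold planarPow
  rw [h]
  split_ifs <;> simp

/-- Conjugation of harmonics is realised by an area-preserving reflection, which forces the triple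
products to be real. -/
lemma Y_refl (n : ℕ) (x : S2) : Y n (sphereMap reflIso x) = conj (Y n x) := by
  have h2 : (sphereMap reflIso x).1 2 = x.1 2 := by simp [sphereMap, reflIso, isoOfNorm]
  rw [Y_eq, Y_eq, planarPow_refl, h2]
  simp

/-- The triple products are real. -/
lemma conj_T (c k n : ℕ) : conj (T c k n) = T c k n := by
  conv_rhs => rw [T, ← integral_comp_sphereMap reflIso]
  simp only [Y_refl]
  rw [T, ← integral_conj]
  simp

lemma coeff_conj_Y_mul (k n c : ℕ) : coeff (fun x => conj (Y k x) * Y n x) c = T c k n := by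
  rw [← conj_T, T, ← integral_conj, coeff]
  congr 1
  ext x
  simp only [map_mul, Complex.conj_conj]
  ring

lemma conj_Y_mul_mem (k n : ℕ) : (fun x => conj (Y k x) * Y n x) ∈ harmSpan (deg k + deg n) :=
  mul_mem_harmSpan (conj_mem_harmSpan (Y_mem_harmSpan k)) (Y_mem_harmSpan n)

/-- The number of possibly non-zero triple products `T(·; k; n)`. -/
def tripleBound (k n : ℕ) : ℕ := (deg k + deg n + 1) ^ 2

/-- `T c k n` is the `c`-th coefficient of `conj (Y k) * Y n`, a polynomial of degree at most `deg k
+ deg n`. -/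
lemma T_eq_zero {c k n : ℕ} (h : tripleBound k n ≤ c) : T c k n = 0 := by
  rw [← coeff_conj_Y_mul]
  exact coeff_eq_zero_of_mem_harmSpan (conj_Y_mul_mem k n) h

/-- The coefficients of a product in terms of the coefficients of one factor. -/
lemma coeff_Y_mul {f : S2 → ℂ} (hf : MemLp f 2 area) (k n : ℕ) :
    coeff (fun x => Y k x * f x) n =
      ∑ c ∈ Finset.range (tripleBound k n), T c k n * coeff f c := by
  have h1 : ∀ x, Y k x * conj (Y n x) =
      ∑ c ∈ Finset.range (tripleBound k n), T c k n * conj (Y c x) := by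
    intro x
    have h2 := congrArg conj (congrFun (eq_sum_of_mem_harmSpan (conj_Y_mul_mem k n)) x)
    simp only [coeff_conj_Y_mul, map_sum, map_mul, conj_T, Complex.conj_conj] at h2
    exact h2
  have h3 : ∀ x, Y k x * f x * conj (Y n x) =
      ∑ c ∈ Finset.range (tripleBound k n), T c k n * (f x * conj (Y c x)) := by
    intro x
    rw [mul_right_comm, h1, Finset.sum_mul]
    exact Finset.sum_congr rfl fun c _ => by ring
  simp only [coeff, h3]
  rw [integral_finsetSum _ fun c _ => (integrable_mul_conj_Y hf c).const_mul _]
  simp only [integral_const_mul]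

end TripleProduct

/-! ### The mean-square error in the spectral domain -/

section Quadratic

variable {Ω : Type*} [MeasurableSpace Ω] {P : Measure Ω}

lemma integrable_mul_conj {U V : Ω → ℂ} (hU : MemLp U 2 P) (hV : MemLp V 2 P) :
    Integrable (fun ω => U ω * conj (V ω)) P :=
  hU.integrable_mul hV.star

lemma enorm_sq_eq_ofReal (a : ℂ) : ‖a‖ₑ ^ 2 = ENNReal.ofReal (‖a‖ ^ 2) := by
  rw [← ofReal_norm, ENNReal.ofReal_pow (norm_nonneg _)]

/-- The error of a scalar filter applied to the sum of two orthogonal random variables. -/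
lemma lintegral_filter_error {U V : Ω → ℂ} (hU : MemLp U 2 P) (hV : MemLp V 2 P)
    (huv : ∫ ω, U ω * conj (V ω) ∂P = 0) (w : ℂ) :
    ∫⁻ ω, ‖(U ω + V ω) * w - U ω‖ₑ ^ 2 ∂P =
      ENNReal.ofReal (‖w - 1‖ ^ 2 * ∫ ω, ‖U ω‖ ^ 2 ∂P + ‖w‖ ^ 2 * ∫ ω, ‖V ω‖ ^ 2 ∂P) := by
  have hm : MemLp (fun ω => (U ω + V ω) * w - U ω) 2 P := by
    have h := (hU.const_mul (w - 1)).add (hV.const_mul w)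
    convert h using 1
    ext ω
    simp only [Pi.add_apply]
    ring
  simp only [enorm_sq_eq_ofReal]
  rw [← ofReal_integral_eq_lintegral_ofReal hm.norm.integrable_sq
    (.of_forall fun ω => by positivity)]
  congr 1
  -- The error is `(w - 1) U + w V`; its cross term has mean zero by `huv`.
  have h1 : ∀ ω, ‖(U ω + V ω) * w - U ω‖ ^ 2 = ‖w - 1‖ ^ 2 * ‖U ω‖ ^ 2 + ‖w‖ ^ 2 * ‖V ω‖ ^ 2 +
      2 * ((w - 1) * conj w * (U ω * conj (V ω))).re := by
    intro ω
    have h2 : (U ω + V ω) * w - U ω = (w - 1) * U ω + w * V ω := by ring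
    rw [h2, ← Complex.normSq_eq_norm_sq, Complex.normSq_add, Complex.normSq_eq_norm_sq,
      Complex.normSq_eq_norm_sq, norm_mul, norm_mul, mul_pow, mul_pow, map_mul]
    congr 3
    ring
  have hi := (integrable_mul_conj hU hV).const_mul ((w - 1) * conj w)
  have h3 : ∫ ω, ((w - 1) * conj w * (U ω * conj (V ω))).re ∂P = 0 := by
    have h4 : ∫ ω, ((w - 1) * conj w * (U ω * conj (V ω))).re ∂P =
        (∫ ω, (w - 1) * conj w * (U ω * conj (V ω)) ∂P).re := integral_re hi
    rw [h4, integral_const_mul, huv]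
    simp
  have hUi : Integrable (fun ω => ‖U ω‖ ^ 2) P := hU.norm.integrable_sq
  have hVi : Integrable (fun ω => ‖V ω‖ ^ 2) P := hV.norm.integrable_sq
  have hre : Integrable (fun ω => ((w - 1) * conj w * (U ω * conj (V ω))).re) P := hi.re
  simp only [h1]
  have hUV : Integrable (fun ω => ‖w - 1‖ ^ 2 * ‖U ω‖ ^ 2 + ‖w‖ ^ 2 * ‖V ω‖ ^ 2) P :=
    (hUi.const_mul _).add (hVi.const_mul _)
  rw [integral_add hUV (hre.const_mul _), integral_add (hUi.const_mul _) (hVi.const_mul _), integral_const_mul, integral_const_mul,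
    integral_const_mul, h3]
  ring

/-- Completing the square. -/
lemma filter_error_eq {a b : ℝ} (hab : a + b ≠ 0) (w : ℂ) :
    ‖w - 1‖ ^ 2 * a + ‖w‖ ^ 2 * b =
      (a + b) * ‖w - ((a / (a + b) : ℝ) : ℂ)‖ ^ 2 + a * b / (a + b) := by
  simp only [← Complex.normSq_eq_norm_sq, Complex.normSq_apply, Complex.sub_re, Complex.sub_im,
    Complex.one_re, Complex.one_im, Complex.ofReal_re, Complex.ofReal_im]
  field_simp
  ring

end Quadratic

/-! ### Decoupling of the mean-square error into scalar problems. -/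

section MeanSquare

variable {Ω : Type*} [MeasurableSpace Ω] {P : Measure Ω}

lemma enorm_coeff_sq_le {f : S2 → ℂ} (hf : MemLp f 2 area) (n : ℕ) :
    ‖coeff f n‖ₑ ^ 2 ≤ ∫⁻ x, ‖f x‖ₑ ^ 2 ∂area :=
  (ENNReal.le_tsum n).trans (tsum_enorm_coeff_sq_le hf)

lemma IsZeroMeanProcess.memLp_coeff {s : Ω → S2 → ℂ} (hs : IsZeroMeanProcess P s) (n : ℕ) :
    MemLp (fun ω => coeff (s ω) n) 2 P := by
  refine ⟨hs.aestronglyMeasurable_coeff n, ?_⟩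
  rw [eLpNorm_lt_top_iff_lintegral_rpow_enorm_lt_top (by simp) (by simp)]
  refine lt_of_le_of_lt (lintegral_mono_ae ?_) hs.finite_energy
  filter_upwards [hs.memLp] with ω hω
  simpa using enorm_coeff_sq_le hω n

/-- The coefficient of index `n` of the product of `Y_k` with the process `s`. -/
def prodCoeff (s : Ω → S2 → ℂ) (k n : ℕ) (ω : Ω) : ℂ :=
  ∑ c ∈ Finset.range (tripleBound k n), T c k n * coeff (s ω) c

lemma memLp_prodCoeff {s : Ω → S2 → ℂ} (hs : IsZeroMeanProcess P s) (k n : ℕ) :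
    MemLp (prodCoeff s k n) 2 P :=
  memLp_finsetSum _ fun c _ => (hs.memLp_coeff c).const_mul _

lemma integral_prodCoeff_mul_conj {s z : Ω → S2 → ℂ} (hs : IsZeroMeanProcess P s)
    (hz : IsZeroMeanProcess P z) (k n : ℕ) :
    ∫ ω, prodCoeff s k n ω * conj (prodCoeff z k n ω) ∂P =
      ∑ c ∈ Finset.range (tripleBound k n), ∑ c' ∈ Finset.range (tripleBound k n),
        T c k n * T c' k n * ∫ ω, coeff (s ω) c * conj (coeff (z ω) c') ∂P := by
  have h1 : ∀ ω, prodCoeff s k n ω * conj (prodCoeff z k n ω) =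
      ∑ c ∈ Finset.range (tripleBound k n), ∑ c' ∈ Finset.range (tripleBound k n),
        T c k n * T c' k n * (coeff (s ω) c * conj (coeff (z ω) c')) := by
    intro ω
    rw [prodCoeff, prodCoeff, map_sum, Finset.sum_mul_sum]
    refine Finset.sum_congr rfl fun c _ => Finset.sum_congr rfl fun c' _ => ?_
    rw [map_mul, conj_T]
    ring
  have hi (c c' : ℕ) := (integrable_mul_conj (hs.memLp_coeff c) (hz.memLp_coeff c')).const_mul
    (T c k n * T c' k n)
  simp only [h1]
  rw [integral_finsetSum _ fun c _ => integrable_finsetSum _ fun c' _ => hi c c']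
  refine Finset.sum_congr rfl fun c _ => ?_
  rw [integral_finsetSum _ fun c' _ => hi c c']
  simp only [integral_const_mul]

lemma integral_prodCoeff_eq_zero {s z : Ω → S2 → ℂ} (hs : IsZeroMeanProcess P s)
    (hz : IsZeroMeanProcess P z) (hsz : Uncorrelated P s z) (k n : ℕ) :
    ∫ ω, prodCoeff s k n ω * conj (prodCoeff z k n ω) ∂P = 0 := by
  rw [integral_prodCoeff_mul_conj hs hz]
  exact Finset.sum_eq_zero fun c _ => Finset.sum_eq_zero fun c' _ => by rw [hsz c c', mul_zero]

/-- The triple products have finite support in `c`, so no summability question arises for any matrix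
`C`. -/
lemma quadSum_eq_sum (h : S2 → ℂ) (C : ℕ → ℕ → ℂ) (r n : ℕ) :
    quadSum h C r n = windowFactor h r ^ 2 *
      ∑ c ∈ Finset.range (tripleBound (negIdx r) n),
        ∑ c' ∈ Finset.range (tripleBound (negIdx r) n),
          T c (negIdx r) n * T c' (negIdx r) n * C c c' := by
  have hz : ∀ c ∉ Finset.range (tripleBound (negIdx r) n), H h c r n = 0 := fun c hc => by
    rw [H_eq, T_eq_zero (by simpa using hc), mul_zero]
  rw [quadSum, tsum_eq_sum (s := Finset.range (tripleBound (negIdx r) n)), Finset.mul_sum]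
  · refine Finset.sum_congr rfl fun c _ => ?_
    rw [tsum_eq_sum (s := Finset.range (tripleBound (negIdx r) n)), Finset.mul_sum]
    · refine Finset.sum_congr rfl fun c' _ => ?_
      rw [H_eq, H_eq]
      ring
    · intro c' hc'
      rw [hz c' hc', mul_zero, zero_mul]
  · intro c hc
    simp [hz c hc]

/-- The mean energy of `prodCoeff`. -/
def prodEnergy (P : Measure Ω) (s : Ω → S2 → ℂ) (k n : ℕ) : ℝ :=
  ∫ ω, ‖prodCoeff s k n ω‖ ^ 2 ∂P

lemma prodEnergy_nonneg (s : Ω → S2 → ℂ) (k n : ℕ) : 0 ≤ prodEnergy P s k n :=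
  integral_nonneg fun _ => by positivity

/-- Reality of `T` makes the unconjugated form Hermitian up to the window. The window enters as a
square, not a squared modulus, which is harmless because it cancels in the quotient. -/
lemma quadSum_specCov {s : Ω → S2 → ℂ} (hs : IsZeroMeanProcess P s) (h : S2 → ℂ) (r n : ℕ) :
    quadSum h (specCov P s) r n = windowFactor h r ^ 2 * (prodEnergy P s (negIdx r) n : ℝ) := by
  rw [quadSum_eq_sum]
  congr 1
  refine (integral_prodCoeff_mul_conj hs hs (negIdx r) n).symm.trans ?_
  rw [prodEnergy, ← integral_complex_ofReal]
  congr 1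
  ext ω
  rw [Complex.mul_conj']
  push_cast
  rfl

lemma quadSum_add (h : S2 → ℂ) (C C' : ℕ → ℕ → ℂ) (r n : ℕ) :
    quadSum h (fun c c' => C c c' + C' c c') r n = quadSum h C r n + quadSum h C' r n := by
  simp only [quadSum_eq_sum, mul_add, Finset.sum_add_distrib]

/-- The contribution of the coefficient `(n, r)` to the mean-square error of a filter
with value `w` there. -/
def errTerm (P : Measure Ω) (h : S2 → ℂ) (s z : Ω → S2 → ℂ) (n r : ℕ) (w : ℂ) : ℝ≥0∞ :=
  ∫⁻ ω, ‖windowFactor h r * ((prodCoeff s (negIdx r) n ω + prodCoeff z (negIdx r) n ω) * w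
    - prodCoeff s (negIdx r) n ω)‖ₑ ^ 2 ∂P

lemma errTerm_eq {s z : Ω → S2 → ℂ} (hs : IsZeroMeanProcess P s)
    (hz : IsZeroMeanProcess P z) (hsz : Uncorrelated P s z) (h : S2 → ℂ) (n r : ℕ) (w : ℂ) :
    errTerm P h s z n r w = ENNReal.ofReal (‖windowFactor h r‖ ^ 2 *
      (‖w - 1‖ ^ 2 * prodEnergy P s (negIdx r) n + ‖w‖ ^ 2 * prodEnergy P z (negIdx r) n)) := by
  simp only [errTerm, enorm_mul, mul_pow]
  rw [lintegral_const_mul' _ _ (by simp), lintegral_filter_error (memLp_prodCoeff hs _ _)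
    (memLp_prodCoeff hz _ _) (integral_prodCoeff_eq_zero hs hz hsz _ _), enorm_sq_eq_ofReal,
    ← ENNReal.ofReal_mul (by positivity)]
  rfl

lemma slsht_diff {L : ℕ} {h : S2 → ℂ} (hh : IsWindow L h) {ζ : ℕ → S2 → ℂ} (hζ : IsFilter L ζ)
    {f s : S2 → ℂ} (hf : MemLp f 2 area) (hs : MemLp s 2 area) (n : ℕ) (y : S2) :
    filtered h f ζ n y - slsht h s n y = ∑ r ∈ Finset.range ((L + 1) ^ 2),
      windowFactor h r * (coeff (fun x => Y (negIdx r) x * f x) n * coeff (ζ n) r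
        - coeff (fun x => Y (negIdx r) x * s x) n) * Y r y := by
  have h1 : ∀ r ∈ Finset.range ((L + 1) ^ 2), coeff (slsht h f n) r =
      windowFactor h r * coeff (fun x => Y (negIdx r) x * f x) n := by
    intro r hr
    rw [funext (slsht_eq hh hf n), coeff_sum _
      (fun r => windowFactor h r * coeff (fun x => Y (negIdx r) x * f x) n), if_pos hr]
  rw [filtered, conv, tsum_eq_sum (s := Finset.range ((L + 1) ^ 2)), slsht_eq hh hs,
    ← Finset.sum_sub_distrib]
  · refine Finset.sum_congr rfl fun r hr => ?_
    rw [h1 r hr]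
    ring
  · intro r hr
    rw [Finset.mem_range, ← deg_le_iff, not_le] at hr
    rw [(hζ n).2 r hr, mul_zero, zero_mul]

/-- Finite Parseval for almost every realisation, then Tonelli; in `ℝ≥0∞` this holds even if the
error is infinite. -/
lemma mse_eq {L : ℕ} {h : S2 → ℂ} (hh : IsWindow L h) {f s z : Ω → S2 → ℂ}
    (hf : ∀ ω x, f ω x = s ω x + z ω x)
    (hs : IsZeroMeanProcess P s) (hz : IsZeroMeanProcess P z)
    {ζ : ℕ → S2 → ℂ} (hζ : IsFilter L ζ) :
    mse P h f s ζ = ∑' i : ℕ × Fin ((L + 1) ^ 2), errTerm P h s z i.1 i.2 (coeff (ζ i.1) i.2) := by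
  have hm (r n : ℕ) (w : ℂ) : AEMeasurable (fun ω => ‖windowFactor h r *
      ((prodCoeff s (negIdx r) n ω + prodCoeff z (negIdx r) n ω) * w
        - prodCoeff s (negIdx r) n ω)‖ₑ ^ 2) P := by
    have h1 := (memLp_prodCoeff hs (negIdx r) n).aestronglyMeasurable
    have h2 := (memLp_prodCoeff hz (negIdx r) n).aestronglyMeasurable
    exact ((((h1.add h2).mul_const w).sub h1).const_mul (windowFactor h r)).enorm.pow_const 2
  have h1 : mse P h f s ζ = ∫⁻ ω, ∑' n, ∑ r ∈ Finset.range ((L + 1) ^ 2), ‖windowFactor h r *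
      ((prodCoeff s (negIdx r) n ω + prodCoeff z (negIdx r) n ω) * coeff (ζ n) r
        - prodCoeff s (negIdx r) n ω)‖ₑ ^ 2 ∂P := by
    refine lintegral_congr_ae ?_
    filter_upwards [hs.memLp, hz.memLp] with ω hsω hzω
    have hfω : MemLp (f ω) 2 area := by
      rw [funext (hf ω)]
      exact hsω.add hzω
    have hfc : ∀ n, coeff (f ω) n = coeff (s ω) n + coeff (z ω) n := fun n => by
      rw [funext (hf ω), coeff_add hsω hzω]
    refine tsum_congr fun n => ?_
    simp only [slsht_diff hh hζ hfω hsω n]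
    rw [lintegral_enorm_sum_Y _ (fun r => windowFactor h r *
      (coeff (fun x => Y (negIdx r) x * f ω x) n * coeff (ζ n) r
        - coeff (fun x => Y (negIdx r) x * s ω x) n))]
    refine Finset.sum_congr rfl fun r _ => ?_
    rw [coeff_Y_mul hfω, coeff_Y_mul hsω]
    simp only [hfc, mul_add, Finset.sum_add_distrib]
    rfl
  rw [h1, lintegral_tsum fun n => Finset.aemeasurable_fun_sum _ fun r _ => hm r n _,
    ENNReal.tsum_prod']
  refine tsum_congr fun n => ?_
  rw [lintegral_finsetSum' _ fun r _ => hm r n _, tsum_fintype,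
    Fin.sum_univ_eq_sum_range (fun r => errTerm P h s z n r (coeff (ζ n) r))]
  rfl

/-- Bessel's inequality for `Y k * s`, whose energy is at most `sup |Y k|²` times that of `s`. -/
lemma tsum_prodCoeff_lt_top {s : Ω → S2 → ℂ} (hs : IsZeroMeanProcess P s) (k : ℕ) :
    ∑' n, ∫⁻ ω, ‖prodCoeff s k n ω‖ₑ ^ 2 ∂P < ∞ := by
  obtain ⟨C, hC⟩ := isCompact_univ.exists_bound_of_continuousOn (continuous_Y k).continuousOn
  rw [← lintegral_tsum fun n =>
    (memLp_prodCoeff hs k n).aestronglyMeasurable.enorm.pow_const 2]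
  refine lt_of_le_of_lt (b := ENNReal.ofReal C ^ 2 * ∫⁻ ω, ∫⁻ x, ‖s ω x‖ₑ ^ 2 ∂area ∂P) ?_
    (ENNReal.mul_lt_top (by simp) hs.finite_energy)
  rw [← lintegral_const_mul' _ _ (by simp)]
  refine lintegral_mono_ae ?_
  filter_upwards [hs.memLp] with ω hω
  calc ∑' n, ‖prodCoeff s k n ω‖ₑ ^ 2
      = ∑' n, ‖coeff (fun x => Y k x * s ω x) n‖ₑ ^ 2 := by
        simp only [coeff_Y_mul hω]
        rfl
    _ ≤ ∫⁻ x, ‖Y k x * s ω x‖ₑ ^ 2 ∂area := tsum_enorm_coeff_sq_le (memLp_Y_mul hω k)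
    _ ≤ ∫⁻ x, ENNReal.ofReal C ^ 2 * ‖s ω x‖ₑ ^ 2 ∂area := by
        refine lintegral_mono fun x => ?_
        rw [enorm_mul, mul_pow]
        gcongr
        rw [← ofReal_norm]
        exact ENNReal.ofReal_le_ofReal (hC x trivial)
    _ = ENNReal.ofReal C ^ 2 * ∫⁻ x, ‖s ω x‖ₑ ^ 2 ∂area :=
        lintegral_const_mul' _ _ (by simp)

/-- The value `w = 0` stands for the zero filter, a competitor of finite error. -/
lemma tsum_errTerm_zero_lt_top {s : Ω → S2 → ℂ} (hs : IsZeroMeanProcess P s)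
    (h : S2 → ℂ) (z : Ω → S2 → ℂ) (N : ℕ) :
    ∑' i : ℕ × Fin N, errTerm P h s z i.1 i.2 0 < ∞ := by
  rw [ENNReal.tsum_prod', ENNReal.tsum_comm, tsum_fintype, ENNReal.sum_lt_top]
  intro r _
  simp only [errTerm, mul_zero, zero_sub, enorm_mul, enorm_neg, mul_pow]
  simp only [lintegral_const_mul' _ _ (show ‖windowFactor h r‖ₑ ^ 2 ≠ ∞ by simp)]
  rw [ENNReal.tsum_mul_left]
  exact ENNReal.mul_lt_top (by simp) (tsum_prodCoeff_lt_top hs _)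

/-- The coefficients of the optimal filter. -/
def optCoeff (P : Measure Ω) (h : S2 → ℂ) (s z : Ω → S2 → ℂ) (n r : ℕ) : ℂ :=
  if quadSum h (fun c c' => specCov P s c c' + specCov P z c c') r n = 0 then 0
  else quadSum h (specCov P s) r n /
    quadSum h (fun c c' => specCov P s c c' + specCov P z c c') r n

lemma quadSum_specCov_add {s z : Ω → S2 → ℂ} (hs : IsZeroMeanProcess P s)
    (hz : IsZeroMeanProcess P z) (h : S2 → ℂ) (r n : ℕ) :
    quadSum h (fun c c' => specCov P s c c' + specCov P z c c') r n = windowFactor h r ^ 2 *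
      ((prodEnergy P s (negIdx r) n + prodEnergy P z (negIdx r) n : ℝ) : ℂ) := by
  rw [quadSum_add, quadSum_specCov hs, quadSum_specCov hz]
  push_cast
  ring

lemma optCoeff_eq {s z : Ω → S2 → ℂ} (hs : IsZeroMeanProcess P s)
    (hz : IsZeroMeanProcess P z) {h : S2 → ℂ} {n r : ℕ} (hw : windowFactor h r ≠ 0)
    (hab : prodEnergy P s (negIdx r) n + prodEnergy P z (negIdx r) n ≠ 0) :
    optCoeff P h s z n r = ((prodEnergy P s (negIdx r) n /
      (prodEnergy P s (negIdx r) n + prodEnergy P z (negIdx r) n) : ℝ) : ℂ) := by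
  have hab' : ((prodEnergy P s (negIdx r) n + prodEnergy P z (negIdx r) n : ℝ) : ℂ) ≠ 0 := by
    exact_mod_cast hab
  rw [optCoeff, quadSum_specCov_add hs hz, quadSum_specCov hs,
    if_neg (mul_ne_zero (pow_ne_zero 2 hw) hab'), mul_div_mul_left _ _ (pow_ne_zero 2 hw)]
  push_cast
  rfl

lemma errTerm_optCoeff_le {s z : Ω → S2 → ℂ} (hs : IsZeroMeanProcess P s)
    (hz : IsZeroMeanProcess P z) (hsz : Uncorrelated P s z) (h : S2 → ℂ) (n r : ℕ) (w : ℂ) :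
    errTerm P h s z n r (optCoeff P h s z n r) ≤ errTerm P h s z n r w := by
  rw [errTerm_eq hs hz hsz, errTerm_eq hs hz hsz]
  have ha := prodEnergy_nonneg (P := P) s (negIdx r) n
  have hb := prodEnergy_nonneg (P := P) z (negIdx r) n
  by_cases hw : windowFactor h r = 0
  · simp [hw]
  by_cases hab : prodEnergy P s (negIdx r) n + prodEnergy P z (negIdx r) n = 0
  -- Non-negative energies with zero sum both vanish, so the term is zero for every `w`.
  · rw [show prodEnergy P s (negIdx r) n = 0 by linarith,
      show prodEnergy P z (negIdx r) n = 0 by linarith]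
    simp
  refine ENNReal.ofReal_le_ofReal (mul_le_mul_of_nonneg_left ?_ (by positivity))
  rw [optCoeff_eq hs hz hw hab, filter_error_eq hab, filter_error_eq hab, sub_self]
  simp only [norm_zero]
  have : 0 ≤ (prodEnergy P s (negIdx r) n + prodEnergy P z (negIdx r) n) *
    ‖w - ((prodEnergy P s (negIdx r) n /
      (prodEnergy P s (negIdx r) n + prodEnergy P z (negIdx r) n) : ℝ) : ℂ)‖ ^ 2 := by positivity
  linarith

lemma errTerm_optCoeff_lt {s z : Ω → S2 → ℂ} (hs : IsZeroMeanProcess P s)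
    (hz : IsZeroMeanProcess P z) (hsz : Uncorrelated P s z) {h : S2 → ℂ} {n r : ℕ} {w : ℂ}
    (hq : quadSum h (fun c c' => specCov P s c c' + specCov P z c c') r n ≠ 0)
    (hne : w ≠ optCoeff P h s z n r) :
    errTerm P h s z n r (optCoeff P h s z n r) < errTerm P h s z n r w := by
  rw [errTerm_eq hs hz hsz, errTerm_eq hs hz hsz]
  have ha := prodEnergy_nonneg (P := P) s (negIdx r) n
  have hb := prodEnergy_nonneg (P := P) z (negIdx r) n
  rw [quadSum_specCov_add hs hz] at hq
  have hw : windowFactor h r ≠ 0 := fun h0 => hq (by simp [h0])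
  have hab : prodEnergy P s (negIdx r) n + prodEnergy P z (negIdx r) n ≠ 0 :=
    fun h0 => hq (by rw [h0]; simp)
  have hpos : 0 < prodEnergy P s (negIdx r) n + prodEnergy P z (negIdx r) n :=
    lt_of_le_of_ne (by positivity) hab.symm
  rw [optCoeff_eq hs hz hw hab] at *
  have h1 : 0 < ‖w - ((prodEnergy P s (negIdx r) n /
      (prodEnergy P s (negIdx r) n + prodEnergy P z (negIdx r) n) : ℝ) : ℂ)‖ :=
    norm_pos_iff.2 (sub_ne_zero.2 hne)
  have h2 : 0 < ‖windowFactor h r‖ := norm_pos_iff.2 hw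
  rw [filter_error_eq hab, filter_error_eq hab, sub_self, norm_zero]
  have h3 := mul_pos hpos (pow_pos h1 2)
  have h4 : 0 ≤ prodEnergy P s (negIdx r) n * prodEnergy P z (negIdx r) n /
    (prodEnergy P s (negIdx r) n + prodEnergy P z (negIdx r) n) := by positivity
  rw [ENNReal.ofReal_lt_ofReal_iff (mul_pos (pow_pos h2 2) (by linarith))]
  exact mul_lt_mul_of_pos_left (by linarith) (pow_pos h2 2)

/-- There is a filter with prescribed coefficients. -/
lemma exists_filter (L : ℕ) (c : ℕ → ℕ → ℂ) :
    ∃ ζ, IsFilter L ζ ∧ ∀ n, ∀ r < (L + 1) ^ 2, coeff (ζ n) r = c n r := by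
  refine ⟨fun n x => ∑ r ∈ Finset.range ((L + 1) ^ 2), c n r * Y r x, fun n =>
    ⟨memLp_of_continuous (continuous_sum_Y _ _) 2, fun r hr => ?_⟩, fun n r hr => ?_⟩
  · rw [coeff_sum, if_neg]
    rwa [Finset.mem_range, ← deg_le_iff, not_le]
  · rw [coeff_sum, if_pos (Finset.mem_range.2 hr)]

end MeanSquare

end SLSHT

end

/-! ### The optimal filter. -/

theorem theorem1 {Ω : Type*} [MeasurableSpace Ω] (P : Measure Ω) [IsProbabilityMeasure P]
    (L : ℕ) (h : SLSHT.S2 → ℂ) (hh : SLSHT.IsWindow L h)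
    (f s z : Ω → SLSHT.S2 → ℂ)
    (hf : ∀ ω x, f ω x = s ω x + z ω x)
    (hs : SLSHT.IsZeroMeanProcess P s) (hz : SLSHT.IsZeroMeanProcess P z)
    (hsz : SLSHT.Uncorrelated P s z)
    (CS CZ : ℕ → ℕ → ℂ) (hCS : CS = SLSHT.specCov P s) (hCZ : CZ = SLSHT.specCov P z)
    (opt : ℕ → ℕ → ℂ)
    (hopt : ∀ n r, opt n r =
      if SLSHT.quadSum h (fun c c' => CS c c' + CZ c c') r n = 0 then 0
      else SLSHT.quadSum h CS r n / SLSHT.quadSum h (fun c c' => CS c c' + CZ c c') r n) :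
    -- there is an admissible filter with the prescribed coefficients
    (∃ ζ, SLSHT.IsFilter L ζ ∧ ∀ n, ∀ r ≤ L ^ 2 + 2 * L, SLSHT.coeff (ζ n) r = opt n r) ∧
    -- every such filter minimises the mean-square error
    (∀ ζ, SLSHT.IsFilter L ζ →
      (∀ n, ∀ r ≤ L ^ 2 + 2 * L, SLSHT.coeff (ζ n) r = opt n r) →
      SLSHT.IsOptimalFilter P L h f s ζ) ∧
    -- every minimiser has these coefficients wherever the denominator does not vanish
    (∀ ζ, SLSHT.IsOptimalFilter P L h f s ζ → ∀ n, ∀ r ≤ L ^ 2 + 2 * L,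
      SLSHT.quadSum h (fun c c' => CS c c' + CZ c c') r n ≠ 0 →
      SLSHT.coeff (ζ n) r = opt n r) := by
  subst hCS hCZ
  -- These are exactly the indices of degree at most `L`.
  have hle : ∀ r, r ≤ L ^ 2 + 2 * L ↔ r < (L + 1) ^ 2 := fun r => by
    rw [show (L + 1) ^ 2 = L ^ 2 + 2 * L + 1 by ring, Nat.lt_succ_iff]
  have hopt' : ∀ n r, opt n r = SLSHT.optCoeff P h s z n r := hopt
  simp only [hle, hopt']
  refine ⟨SLSHT.exists_filter L _, fun ζ hζ hc => ⟨hζ, fun ξ hξ => ?_⟩,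
    fun ζ ⟨hζ, hmin⟩ n r hr hq => ?_⟩
  · rw [SLSHT.mse_eq hh hf hs hz hζ, SLSHT.mse_eq hh hf hs hz hξ]
    refine ENNReal.tsum_le_tsum fun i => ?_
    rw [hc i.1 i.2 i.2.2]
    exact SLSHT.errTerm_optCoeff_le hs hz hsz h _ _ _
  · by_contra hne
    obtain ⟨ξ, hξ, hc⟩ := SLSHT.exists_filter L (SLSHT.optCoeff P h s z)
    have h1 := hmin ξ hξ
    rw [SLSHT.mse_eq hh hf hs hz hζ, SLSHT.mse_eq hh hf hs hz hξ] at h1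
    -- A wrong coefficient at `(n, r)` makes one term strictly larger. The strict inequality passes
    -- to the sums only because the smaller one is finite, by comparison with the zero filter.
    refine absurd h1 (not_le.2 (ENNReal.tsum_lt_tsum ?_ (i := (n, ⟨r, hr⟩)) (fun i => ?_) ?_))
    · refine ne_top_of_le_ne_top (SLSHT.tsum_errTerm_zero_lt_top hs h z ((L + 1) ^ 2)).ne
        (ENNReal.tsum_le_tsum fun i => ?_)
      rw [hc i.1 i.2 i.2.2]
      exact SLSHT.errTerm_optCoeff_le hs hz hsz h _ _ _
    · rw [hc i.1 i.2 i.2.2]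
      exact SLSHT.errTerm_optCoeff_le hs hz hsz h _ _ _
    · simp only
      rw [hc n r hr]
      exact SLSHT.errTerm_optCoeff_lt hs hz hsz hq hne
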